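/- Let $\mathbf F$ be an algebraically closed field of characteristic $p>2$ and let $\mathfrak g=gl(m|n)$, with basis of matrix units $e_{ab}$ ($1\le a,b\le m+n$), superbracket $[x,y]=xy-(-1)^{\mathrm p(x)\mathrm p(y)}yx$ on homogeneous elements, and $p$-map $x^{[p]}=x^p$ on $\mathfrak g_{\bar 0}=gl(m)\oplus gl(n)$. Let $H$ be the diagonal matrices, $\Phi=\{\epsilon_a-\epsilon_b : a\neq b\}$ the roots, with $\mathfrak g_{\epsilon_a-\epsilon_b}=\mathbf F e_{ab}$. Fix any positive system $\Phi^+$, i.e. a strict total order $\prec$ of the indices with $\epsilon_a-\epsilon_b\in\Phi^+$ iff $a\prec b$; put $\mathfrak N^+=\bigoplus_{\alpha\in\Phi^+}\mathfrak g_\alpha$, $\mathfrak B=H+\mathfrak N^+$, $f_\alpha=e_{ba}$ for $\alpha=\epsilon_a-\epsilon_b$, and let $\Delta_0$ be the set of even roots among the simple roots of $\Phi^+$ (the positive roots that are not sums of two positive roots). For $\chi\in\mathfrak g_{\bar 0}^*$, extended by $0$ to $\mathfrak g_{\bar 1}$, and a restricted subalgebra $\mathfrak a\subseteq\mathfrak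 g$, let $u(\mathfrak a,\chi)$ be the quotient of the enveloping superalgebra $U(\mathfrak a)$ by the ideal generated by the elements $x^p-x^{[p]}-\chi(x)^p$, $x\in\mathfrak a_{\bar 0}$. If $\chi(\mathfrak N^+)=0$ and $\lambda\in H^*$ satisfies $\lambda(h)^p-\lambda(h^{[p]})=\chi(h)^p$ for all $h\in H$, let $\mathbf Fv$ be the one-dimensional $u(\mathfrak B,\chi)$-module with $\mathfrak N^+v=0$ and $hv=\lambda(h)v$ for $h\in H$, and let $Z^\chi(\lambda)=u(\mathfrak g,\chi)\otimes_{u(\mathfrak B,\chi)}\mathbf Fv$ be the baby Verma module, $\mathbf Z_2$-graded by $Z_{\bar i}=u(\mathfrak g,\chi)_{\bar i}\,v$. We say that $\chi$ has standard Levi form if $\chi(\mathfrak B)=0$ and there is a subset $I\subseteq\Delta_0$ such that $\chi(f_\alpha)\ne0$ for $\alpha\in I$ and $\chi(f_\alpha)=0$ for $\alpha\in\Phi\setminus I$. Proposition 5.16. If $\chi$ has standard Levi form, then each baby Verma module $Z^\chi(\lambda)$ has a unique maximal submodule: it has exactly one maximal proper $u(\mathfrak g,\chi)$-submodule, and it also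 has exactly one maximal element among its proper $\mathbf Z_2$-graded $u(\mathfrak g,\chi)$-submodules. -/

import Mathlib

open scoped TensorProduct

noncomputable section

namespace SuperGL

/-- The matrices of size `(m + n) × (m + n)`: the vector space underlying `gl(m|n)`. -/
abbrev gl (F : Type*) (m n : ℕ) : Type _ := Matrix (Fin m ⊕ Fin n) (Fin m ⊕ Fin n) F

/-- Parity of the basis vectors of `F^{m|n}`: the first `m` are even, the last `n` are odd. -/
def parity {m n : ℕ} : Fin m ⊕ Fin n → ZMod 2 := Sum.elim (fun _ => 0) (fun _ => 1)

/-- The sign `(-1)^(i j)`. -/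
def sgn (F : Type*) [Field F] (i j : ZMod 2) : F := (-1) ^ (i.val * j.val)

section Grading
variable (F : Type*) [Field F] (m n : ℕ)

/-- The homogeneous part of degree `i` of `gl(m|n)`; the matrix unit `e_{ab}` has
degree `parity a + parity b`. -/
def deg (i : ZMod 2) : Submodule F (gl F m n) where
  carrier := {A | ∀ a b, parity a + parity b ≠ i → A a b = 0}
  zero_mem' := by intro a b _; rfl
  add_mem' := by
    intro A B hA hB a b h
    simp [hA a b h, hB a b h]
  smul_mem' := by
    intro c A hA a b h
    simp [hA a b h]

/-- The projection of `gl(m|n)` onto its homogeneous part of degree `i`. -/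
def proj (i : ZMod 2) : gl F m n →ₗ[F] deg F m n i where
  toFun A := ⟨Matrix.of fun a b => if parity a + parity b = i then A a b else 0, by
    intro a b h
    simp [h]⟩
  map_add' A B := by
    ext a b
    by_cases h : parity a + parity b = i <;> simp [h]
  map_smul' c A := by
    ext a b
    by_cases h : parity a + parity b = i <;> simp [h]

/-- The space of `p`-characters: linear forms on the even part of `gl(m|n)`. -/
abbrev PChar : Type _ := Module.Dual F (deg F m n 0)

/-- The diagonal matrices `H`. -/
def cartan : Submodule F (gl F m n) where
  carrier := {A | ∀ a b, a ≠ b → A a b = 0}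
  zero_mem' := by intro a b _; rfl
  add_mem' := by
    intro A B hA hB a b h
    simp [hA a b h, hB a b h]
  smul_mem' := by
    intro c A hA a b h
    simp [hA a b h]

/-- The projection of a matrix onto its diagonal. -/
def toCartan : gl F m n →ₗ[F] cartan F m n where
  toFun A := ⟨Matrix.diagonal A.diag, fun a b h => Matrix.diagonal_apply_ne _ h⟩
  map_add' A B := by
    ext a b
    by_cases h : a = b
    · subst h; simp
    · simp [h]
  map_smul' c A := by
    ext a b
    by_cases h : a = b
    · subst h; simp
    · simp [h]

end Grading

section Basic
variable {F : Type*} [Field F] {m n : ℕ}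

/-- `χ` regarded as a linear form on all of `gl(m|n)` that vanishes on the odd part. -/
def PChar.ext (χ : PChar F m n) : gl F m n →ₗ[F] F := χ ∘ₗ proj F m n 0

/-- The superbracket `[A,B] = AB - (-1)^(ij) BA` of `A` of degree `i` and `B` of degree `j`. -/
def superBracket (i j : ZMod 2) (A B : gl F m n) : gl F m n := A * B - sgn F i j • (B * A)

theorem proj_of_mem {i : ZMod 2} {A : gl F m n} (hA : A ∈ deg F m n i) :
    proj F m n i A = ⟨A, hA⟩ := by
  ext a b
  by_cases h : parity a + parity b = i
  · simp [proj, h]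
  · simp [proj, h, hA a b h]

theorem PChar.ext_of_mem (χ : PChar F m n) {A : gl F m n} (hA : A ∈ deg F m n 0) :
    PChar.ext χ A = χ ⟨A, hA⟩ := by
  simp [PChar.ext, proj_of_mem hA]

theorem cartan_eq_diagonal {h : gl F m n} (hh : h ∈ cartan F m n) :
    h = Matrix.diagonal h.diag := by
  ext a b
  by_cases hab : a = b
  · subst hab; simp
  · rw [Matrix.diagonal_apply_ne _ hab]; exact hh a b hab

theorem cartan_pow_mem (k : ℕ) {h : gl F m n} (hh : h ∈ cartan F m n) :
    h ^ k ∈ cartan F m n := by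
  intro a b hab
  rw [cartan_eq_diagonal hh, Matrix.diagonal_pow]
  exact Matrix.diagonal_apply_ne _ hab

end Basic

/-- A restricted Lie sub-superalgebra of `gl(m|n)`: a graded subspace that is closed under the
superbracket and under the `p`-map `x ↦ x ^ p` of even elements. -/
structure RestrictedSub (F : Type*) [Field F] (m n p : ℕ) where
  carrier : Submodule F (gl F m n)
  graded : ∀ A ∈ carrier, ∀ i : ZMod 2, (proj F m n i A : gl F m n) ∈ carrier
  bracket_mem : ∀ (i j : ZMod 2) (A B : gl F m n), A ∈ carrier → B ∈ carrier →
    A ∈ deg F m n i → B ∈ deg F m n j → superBracket i j A B ∈ carrier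
  pow_mem : ∀ A ∈ carrier, A ∈ deg F m n 0 → A ^ p ∈ carrier

/-- `gl(m|n)` itself. -/
def whole (F : Type*) [Field F] (m n p : ℕ) : RestrictedSub F m n p where
  carrier := ⊤
  graded _ _ _ := Submodule.mem_top
  bracket_mem _ _ _ _ _ _ _ _ := Submodule.mem_top
  pow_mem _ _ _ := Submodule.mem_top

section Enveloping
variable {F : Type*} [Field F] {m n p : ℕ}

/-- The relations `x ⊗ y - (-1)^(p(x)p(y)) y ⊗ x = [x,y]` (for homogeneous `x`, `y`) and
`x^p - x^[p] = χ(x)^p` (for even `x`) on the tensor algebra. -/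
inductive ReducedRel (𝔞 : RestrictedSub F m n p) (χ : PChar F m n) :
    TensorAlgebra F 𝔞.carrier → TensorAlgebra F 𝔞.carrier → Prop
  | bracket (i j : ZMod 2) (x y : 𝔞.carrier)
      (hx : (x : gl F m n) ∈ deg F m n i) (hy : (y : gl F m n) ∈ deg F m n j) :
      ReducedRel 𝔞 χ
        (TensorAlgebra.ι F x * TensorAlgebra.ι F y
          - sgn F i j • (TensorAlgebra.ι F y * TensorAlgebra.ι F x))
        (TensorAlgebra.ι F
          ⟨superBracket i j (x : gl F m n) y, 𝔞.bracket_mem i j x y x.2 y.2 hx hy⟩)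
  | pmap (x : 𝔞.carrier) (hx : (x : gl F m n) ∈ deg F m n 0) :
      ReducedRel 𝔞 χ
        (TensorAlgebra.ι F x ^ p
          - TensorAlgebra.ι F ⟨(x : gl F m n) ^ p, 𝔞.pow_mem x x.2 hx⟩)
        (algebraMap F _ (χ ⟨x, hx⟩ ^ p))

/-- The `χ`-reduced enveloping algebra `u(𝔞, χ)`. -/
abbrev ReducedEnv (𝔞 : RestrictedSub F m n p) (χ : PChar F m n) : Type _ :=
  RingQuot (ReducedRel 𝔞 χ)

/-- The canonical map `𝔞 → u(𝔞, χ)`. -/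
def ReducedEnv.ι (𝔞 : RestrictedSub F m n p) (χ : PChar F m n) :
    𝔞.carrier →ₗ[F] ReducedEnv 𝔞 χ :=
  (RingQuot.mkAlgHom F (ReducedRel 𝔞 χ)).toLinearMap ∘ₗ TensorAlgebra.ι F

theorem ReducedEnv.ι_bracket (𝔞 : RestrictedSub F m n p) (χ : PChar F m n)
    (i j : ZMod 2) (x y : 𝔞.carrier)
    (hx : (x : gl F m n) ∈ deg F m n i) (hy : (y : gl F m n) ∈ deg F m n j) :
    ReducedEnv.ι 𝔞 χ x * ReducedEnv.ι 𝔞 χ y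
      - sgn F i j • (ReducedEnv.ι 𝔞 χ y * ReducedEnv.ι 𝔞 χ x)
      = ReducedEnv.ι 𝔞 χ
        ⟨superBracket i j (x : gl F m n) y, 𝔞.bracket_mem i j x y x.2 y.2 hx hy⟩ := by
  have h := RingQuot.mkAlgHom_rel F (ReducedRel.bracket (χ := χ) i j x y hx hy)
  simp only [map_sub, map_mul, map_smul] at h
  exact h

theorem ReducedEnv.ι_pow (𝔞 : RestrictedSub F m n p) (χ : PChar F m n)
    (x : 𝔞.carrier) (hx : (x : gl F m n) ∈ deg F m n 0) :
    ReducedEnv.ι 𝔞 χ x ^ p - ReducedEnv.ι 𝔞 χ ⟨(x : gl F m n) ^ p, 𝔞.pow_mem x x.2 hx⟩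
      = algebraMap F _ (χ ⟨x, hx⟩ ^ p) := by
  have h := RingQuot.mkAlgHom_rel F (ReducedRel.pmap (χ := χ) x hx)
  simp only [map_sub, map_pow, AlgHom.commutes] at h
  rw [map_pow]
  exact h

/-- A linear map `𝔞 → A` into an associative algebra that respects the superbracket and the
`p`-character relations extends to an algebra homomorphism `u(𝔞, χ) → A`. -/
def ReducedEnv.lift (𝔞 : RestrictedSub F m n p) (χ : PChar F m n)
    {A : Type*} [Ring A] [Algebra F A] (φ : 𝔞.carrier →ₗ[F] A)
    (hb : ∀ (i j : ZMod 2) (x y : 𝔞.carrier)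
      (hx : (x : gl F m n) ∈ deg F m n i) (hy : (y : gl F m n) ∈ deg F m n j),
      φ x * φ y - sgn F i j • (φ y * φ x)
        = φ ⟨superBracket i j (x : gl F m n) y, 𝔞.bracket_mem i j x y x.2 y.2 hx hy⟩)
    (hp : ∀ (x : 𝔞.carrier) (hx : (x : gl F m n) ∈ deg F m n 0),
      φ x ^ p - φ ⟨(x : gl F m n) ^ p, 𝔞.pow_mem x x.2 hx⟩ = algebraMap F A (χ ⟨x, hx⟩ ^ p)) :
    ReducedEnv 𝔞 χ →ₐ[F] A :=
  RingQuot.liftAlgHom F ⟨TensorAlgebra.lift F φ, by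
    rintro _ _ (⟨i, j, x, y, hx, hy⟩ | ⟨x, hx⟩)
    · simpa only [map_sub, map_mul, map_smul, TensorAlgebra.lift_ι_apply] using hb i j x y hx hy
    · simpa only [map_sub, map_pow, TensorAlgebra.lift_ι_apply, AlgHom.commutes] using hp x hx⟩

/-- The homomorphism `u(𝔞, χ) → u(𝔟, χ)` induced by an inclusion `𝔞 ⊆ 𝔟`. -/
def ReducedEnv.incl {𝔞 𝔟 : RestrictedSub F m n p} (h : 𝔞.carrier ≤ 𝔟.carrier)
    (χ : PChar F m n) : ReducedEnv 𝔞 χ →ₐ[F] ReducedEnv 𝔟 χ :=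
  ReducedEnv.lift 𝔞 χ (ReducedEnv.ι 𝔟 χ ∘ₗ Submodule.inclusion h)
    (fun i j x y hx hy =>
      ReducedEnv.ι_bracket 𝔟 χ i j (Submodule.inclusion h x) (Submodule.inclusion h y) hx hy)
    (fun x hx => ReducedEnv.ι_pow 𝔟 χ (Submodule.inclusion h x) hx)

/-- `IsMonomial 𝔞 χ i w`: `w` is a product `x₁ ⋯ x_k` in `u(𝔞, χ)` of homogeneous elements of
`𝔞` whose degrees add up to `i`. -/
inductive IsMonomial (𝔞 : RestrictedSub F m n p) (χ : PChar F m n) :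
    ZMod 2 → ReducedEnv 𝔞 χ → Prop
  | one : IsMonomial 𝔞 χ 0 1
  | cons (i j : ZMod 2) (x : 𝔞.carrier) (w : ReducedEnv 𝔞 χ)
      (hx : (x : gl F m n) ∈ deg F m n i) (hw : IsMonomial 𝔞 χ j w) :
      IsMonomial 𝔞 χ (i + j) (ReducedEnv.ι 𝔞 χ x * w)

/-- The homogeneous part of degree `i` of `u(𝔞, χ)`. -/
def ReducedEnv.part (𝔞 : RestrictedSub F m n p) (χ : PChar F m n) (i : ZMod 2) :
    Submodule F (ReducedEnv 𝔞 χ) :=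
  Submodule.span F {w | IsMonomial 𝔞 χ i w}

end Enveloping

section Induction
variable {F : Type*} [Field F] {A B : Type*} [Ring A] [Algebra F A] [Ring B] [Algebra F B]
  {M : Type*} [AddCommGroup M] [Module F M]

/-- The induced module `A ⊗_B M`, for a homomorphism of algebras `φ : B → A` and a `B`-module
`M` given by `ρ : B → End_F(M)`: the quotient of `A ⊗_F M` by the elements
`a φ(b) ⊗ x - a ⊗ b x`. -/
abbrev Induced (φ : B →ₐ[F] A) (ρ : B →ₐ[F] Module.End F M) : Type _ :=
  (A ⊗[F] M) ⧸
    Submodule.span A {t : A ⊗[F] M | ∃ (a : A) (b : B) (x : M),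
      t = (a * φ b) ⊗ₜ[F] x - a ⊗ₜ[F] (ρ b x)}

end Induction

section Borel
variable (F : Type*) [Field F] (m n : ℕ)
  (r : Fin m ⊕ Fin n → Fin m ⊕ Fin n → Prop)

/-- `N⁺`, the sum of the root spaces `F e_{ab}` of the positive roots `ε_a - ε_b`. A positive
system of `gl(m|n)` is a strict total order `r` on the indices: `ε_a - ε_b` is positive exactly
if `r a b`. -/
def nilPos : Submodule F (gl F m n) where
  carrier := {A | ∀ a b, ¬ r a b → A a b = 0}
  zero_mem' := by intro a b _; rfl
  add_mem' := by
    intro A B hA hB a b h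
    simp [hA a b h, hB a b h]
  smul_mem' := by
    intro c A hA a b h
    simp [hA a b h]

variable {F m n r}

theorem mem_borel_iff [IsStrictTotalOrder (Fin m ⊕ Fin n) r] {A : gl F m n} :
    A ∈ cartan F m n ⊔ nilPos F m n r ↔ ∀ a b, r b a → A a b = 0 := by
  constructor
  · intro h a b hba
    obtain ⟨D, hD, N, hN, rfl⟩ := Submodule.mem_sup.1 h
    have h1 : a ≠ b := by rintro rfl; exact irrefl_of r a hba
    have h2 : ¬ r a b := fun hab => asymm_of r hab hba
    simp [hD a b h1, hN a b h2]
  · intro h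
    refine Submodule.mem_sup.2
      ⟨toCartan F m n A, (toCartan F m n A).2, A - toCartan F m n A, ?_, by simp⟩
    intro a b hab
    by_cases e : a = b
    · subst e; simp [toCartan]
    · have : r b a := by
        rcases trichotomous_of r a b with h1 | h1 | h1
        · exact absurd h1 hab
        · exact absurd h1 e
        · exact h1
      simp [toCartan, e, h a b this]

theorem borel_mul_mem [IsStrictTotalOrder (Fin m ⊕ Fin n) r] {A B : gl F m n}
    (hA : A ∈ cartan F m n ⊔ nilPos F m n r) (hB : B ∈ cartan F m n ⊔ nilPos F m n r) :
    A * B ∈ cartan F m n ⊔ nilPos F m n r := by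
  rw [mem_borel_iff] at *
  intro a b hba
  rw [Matrix.mul_apply]
  refine Finset.sum_eq_zero fun c _ => ?_
  by_cases h : r c a
  · rw [hA a c h, zero_mul]
  · have : r b c := by
      rcases trichotomous_of r a c with h1 | h1 | h1
      · exact trans_of r hba h1
      · exact h1 ▸ hba
      · exact absurd h1 h
    rw [hB c b this, mul_zero]

theorem borel_one_mem [IsStrictTotalOrder (Fin m ⊕ Fin n) r] :
    (1 : gl F m n) ∈ cartan F m n ⊔ nilPos F m n r := by
  rw [mem_borel_iff]
  intro a b hba
  exact Matrix.one_apply_ne (by rintro rfl; exact irrefl_of r a hba)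

theorem borel_pow_mem [IsStrictTotalOrder (Fin m ⊕ Fin n) r] (k : ℕ) {A : gl F m n}
    (hA : A ∈ cartan F m n ⊔ nilPos F m n r) :
    A ^ k ∈ cartan F m n ⊔ nilPos F m n r := by
  induction k with
  | zero => simpa using borel_one_mem
  | succ k ih => rw [pow_succ]; exact borel_mul_mem ih hA

theorem borel_diag_mul [IsStrictTotalOrder (Fin m ⊕ Fin n) r] {A B : gl F m n}
    (hA : A ∈ cartan F m n ⊔ nilPos F m n r) (hB : B ∈ cartan F m n ⊔ nilPos F m n r)
    (a : Fin m ⊕ Fin n) : (A * B) a a = A a a * B a a := by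
  rw [mem_borel_iff] at *
  rw [Matrix.mul_apply, Finset.sum_eq_single a]
  · intro c _ hc
    rcases trichotomous_of r a c with h1 | h1 | h1
    · rw [hB c a h1, mul_zero]
    · exact absurd h1.symm hc
    · rw [hA a c h1, zero_mul]
  · simp

theorem borel_diag_pow [IsStrictTotalOrder (Fin m ⊕ Fin n) r] (k : ℕ) {A : gl F m n}
    (hA : A ∈ cartan F m n ⊔ nilPos F m n r) (a : Fin m ⊕ Fin n) :
    (A ^ k) a a = A a a ^ k := by
  induction k with
  | zero => simp
  | succ k ih => rw [pow_succ, borel_diag_mul (borel_pow_mem k hA) hA, ih, pow_succ]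

variable (F m n r)

/-- The Borel subalgebra `B = H + N⁺`. -/
def borel [IsStrictTotalOrder (Fin m ⊕ Fin n) r] (p : ℕ) : RestrictedSub F m n p where
  carrier := cartan F m n ⊔ nilPos F m n r
  graded A hA i := by
    rw [mem_borel_iff] at *
    intro a b hba
    simp [proj, hA a b hba]
  bracket_mem i j A B hA hB _ _ :=
    Submodule.sub_mem _ (borel_mul_mem hA hB) (Submodule.smul_mem _ _ (borel_mul_mem hB hA))
  pow_mem A hA _ := borel_pow_mem p hA

end Borel

section BabyVerma
variable {F : Type*} [Field F] {m n : ℕ} (p : ℕ)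
  (r : Fin m ⊕ Fin n → Fin m ⊕ Fin n → Prop)

/-- `χ(N⁺) = 0`. -/
def VanishesOnNilPos (χ : PChar F m n) : Prop := ∀ A ∈ nilPos F m n r, PChar.ext χ A = 0

/-- `λ(h)^p - λ(h^[p]) = χ(h)^p` for all `h` in `H`. -/
def IsWeight (χ : PChar F m n) (l : Module.Dual F (cartan F m n)) : Prop :=
  ∀ h : cartan F m n,
    l h ^ p - l ⟨(h : gl F m n) ^ p, cartan_pow_mem p h.2⟩ = PChar.ext χ (h : gl F m n) ^ p

variable {p r}

/-- The character of `u(B, χ)` by which it acts on the line `F v`: `N⁺ v = 0` and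
`h v = λ(h) v` for `h` in `H`. -/
def weightChar [IsStrictTotalOrder (Fin m ⊕ Fin n) r] {χ : PChar F m n}
    (hχ : VanishesOnNilPos r χ) {l : Module.Dual F (cartan F m n)} (hl : IsWeight p χ l) :
    ReducedEnv (borel F m n r p) χ →ₐ[F] F :=
  ReducedEnv.lift (borel F m n r p) χ
    (l ∘ₗ toCartan F m n ∘ₗ (borel F m n r p).carrier.subtype)
    (by
      intro i j x y hx hy
      have key : toCartan F m n (superBracket i j (x : gl F m n) y)
          = (1 - sgn F i j) • toCartan F m n ((x : gl F m n) * y) := by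
        ext a b
        by_cases h : a = b
        · subst h
          simp [toCartan, superBracket, borel_diag_mul x.2 y.2, borel_diag_mul y.2 x.2]
          ring
        · simp [toCartan, h]
      simp only [LinearMap.coe_comp, Function.comp_apply, Submodule.coe_subtype]
      rw [key, map_smul, smul_eq_mul, smul_eq_mul]
      by_cases hij : sgn F i j = 1
      · rw [hij]; ring
      · have hi : i = 1 := by
          by_contra hne
          have h0 : i = 0 := by
            clear key hij hx hy
            revert hne; revert i; decide
          exact hij (by simp [sgn, h0])
        have hj : j = 1 := by
          by_contra hne
          have h0 : j = 0 := by
            clear key hij hx hy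
            revert hne; revert j; decide
          exact hij (by simp [sgn, h0])
        subst hi hj
        have hd : ∀ a : Fin m ⊕ Fin n, parity a + parity a ≠ (1 : ZMod 2) := by
          intro a
          rcases a with a | a <;> simp [parity]
        have hx0 : toCartan F m n (x : gl F m n) = 0 := by
          ext a b
          by_cases h : a = b
          · subst h; simpa [toCartan] using hx a a (hd a)
          · simp [toCartan, h]
        have hxy0 : toCartan F m n ((x : gl F m n) * y) = 0 := by
          ext a b
          by_cases h : a = b
          · subst h; simp [toCartan, borel_diag_mul x.2 y.2, hx a a (hd a)]
          · simp [toCartan, h]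
        rw [hx0, hxy0]; simp)
    (by
      intro x hx
      have h1 : toCartan F m n ((x : gl F m n) ^ p)
          = ⟨(toCartan F m n (x : gl F m n) : gl F m n) ^ p,
              cartan_pow_mem p (toCartan F m n (x : gl F m n)).2⟩ := by
        ext a b
        by_cases h : a = b
        · subst h; simp [toCartan, borel_diag_pow p x.2, Matrix.diagonal_pow]
        · simp [toCartan, h, Matrix.diagonal_pow]
      have h2 : PChar.ext χ (toCartan F m n (x : gl F m n) : gl F m n) = χ ⟨x, hx⟩ := by
        have h3 : (x : gl F m n) - toCartan F m n (x : gl F m n) ∈ nilPos F m n r := by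
          intro a b hab
          by_cases e : a = b
          · subst e; simp [toCartan]
          · have : r b a := by
              rcases trichotomous_of r a b with h1 | h1 | h1
              · exact absurd h1 hab
              · exact absurd h1 e
              · exact h1
            simp [toCartan, e, mem_borel_iff.1 x.2 a b this]
        have h4 := hχ _ h3
        rw [map_sub, sub_eq_zero, PChar.ext_of_mem χ hx] at h4
        exact h4.symm
      simp only [LinearMap.coe_comp, Function.comp_apply, Submodule.coe_subtype]
      rw [h1, hl, h2]
      rfl)

/-- The baby Verma module `Z^χ(λ) = u(g, χ) ⊗_{u(B, χ)} F v`, a module over `u(g, χ)`. -/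
abbrev BabyVerma [IsStrictTotalOrder (Fin m ⊕ Fin n) r] {χ : PChar F m n}
    (hχ : VanishesOnNilPos r χ) {l : Module.Dual F (cartan F m n)} (hl : IsWeight p χ l) :
    Type _ :=
  Induced
    (ReducedEnv.incl (𝔞 := borel F m n r p) (𝔟 := whole F m n p) le_top χ)
    ((Algebra.lmul F F).comp (weightChar hχ hl))

/-- The generator `v = 1 ⊗ v` of the baby Verma module. -/
def BabyVerma.gen [IsStrictTotalOrder (Fin m ⊕ Fin n) r] {χ : PChar F m n}
    (hχ : VanishesOnNilPos r χ) {l : Module.Dual F (cartan F m n)} (hl : IsWeight p χ l) :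
    BabyVerma hχ hl :=
  Submodule.Quotient.mk ((1 : ReducedEnv (whole F m n p) χ) ⊗ₜ[F] (1 : F))

/-- The homogeneous part `u(g, χ)_i v` of degree `i` of the baby Verma module. -/
def BabyVerma.part [IsStrictTotalOrder (Fin m ⊕ Fin n) r] {χ : PChar F m n}
    (hχ : VanishesOnNilPos r χ) {l : Module.Dual F (cartan F m n)} (hl : IsWeight p χ l)
    (i : ZMod 2) : Set (BabyVerma hχ hl) :=
  {z | ∃ u ∈ ReducedEnv.part (whole F m n p) χ i, z = u • BabyVerma.gen hχ hl}

/-- A `ℤ/2`-graded submodule `V = (V ∩ Z_0) + (V ∩ Z_1)` of the baby Verma module. -/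
def BabyVerma.IsGraded [IsStrictTotalOrder (Fin m ⊕ Fin n) r] {χ : PChar F m n}
    {hχ : VanishesOnNilPos r χ} {l : Module.Dual F (cartan F m n)} {hl : IsWeight p χ l}
    (V : Submodule (ReducedEnv (whole F m n p) χ) (BabyVerma hχ hl)) : Prop :=
  ∀ z ∈ V, ∃ z₀ ∈ BabyVerma.part hχ hl 0, ∃ z₁ ∈ BabyVerma.part hχ hl 1,
    z₀ ∈ V ∧ z₁ ∈ V ∧ z = z₀ + z₁

end BabyVerma

section Levi
variable {F : Type*} [Field F] {m n : ℕ} (r : Fin m ⊕ Fin n → Fin m ⊕ Fin n → Prop)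

/-- The pair `α = (a, b)` is an even simple root `ε_a - ε_b`: positive, even, and not a sum of
two positive roots. -/
def IsEvenSimple (α : (Fin m ⊕ Fin n) × (Fin m ⊕ Fin n)) : Prop :=
  r α.1 α.2 ∧ (parity α.1 + parity α.2 : ZMod 2) = 0 ∧ ¬ ∃ c, r α.1 c ∧ r c α.2

/-- `χ` has standard Levi form: `χ(B) = 0`, and there is a set `I` of even simple roots such
that `χ(f_α) ≠ 0` for `α` in `I` and `χ(f_α) = 0` for all other roots `α`, where
`f_α = e_{ba}` for `α = ε_a - ε_b`. -/
def HasStandardLeviForm (χ : PChar F m n) : Prop :=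
  (∀ A ∈ cartan F m n ⊔ nilPos F m n r, PChar.ext χ A = 0) ∧
  ∃ I : Set ((Fin m ⊕ Fin n) × (Fin m ⊕ Fin n)), (∀ α ∈ I, IsEvenSimple r α) ∧
    ∀ α : (Fin m ⊕ Fin n) × (Fin m ⊕ Fin n), α.1 ≠ α.2 →
      (α ∈ I → PChar.ext χ (Matrix.single α.2 α.1 1) ≠ 0) ∧
      (α ∉ I → PChar.ext χ (Matrix.single α.2 α.1 1) = 0)

variable {r}

theorem HasStandardLeviForm.vanishesOnNilPos {χ : PChar F m n}
    (h : HasStandardLeviForm r χ) : VanishesOnNilPos r χ :=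
  fun A hA => h.1 A (Submodule.mem_sup_right hA)

end Levi

end SuperGL

end

/-! Write `v` for the generator of $Z^\chi(\lambda)$ and put $y_{ij}=e_{ij}-\chi(e_{ij})$ for the
negative root vectors $e_{ij}$ (that is, $j\prec i$). In standard Levi form $\chi$ is nonzero only
at negatives of even simple roots, so it vanishes on all brackets of negative root vectors. The
$y_{ij}$ therefore satisfy the same bracket relations as the $e_{ij}$. Moreover $y_{ij}^p=0$: for an
even root because $e_{ij}^p=\chi(e_{ij})^p$, for an odd one because $e_{ij}^2=0$ and
$\chi(e_{ij})=0$. An Engel-type induction (`exists_span_pow_eq_bot`) shows that the span $G$ of the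
$y_{ij}$ is nilpotent as a subspace of $u(\mathfrak g,\chi)$.

Let $B$ be the unital algebra generated by the $y_{ij}$. It equals $F+I$ with $I=GB$ nil, so $c+a$
is invertible for $c\in F^\times$, $a\in I$. Since $Z=Bv$ (`BabyVerma.exists_lower_smul_gen`), a
submodule containing some $(c+a)v$ with $c\neq0$ is everything. Hence every proper submodule lies in
$Iv$, and the largest submodule inside $Iv$ is the greatest proper submodule
(`exists_greatest_proper`). The sum of all graded submodules inside it settles the graded case.

This needs $v\neq0$, which is proved without a PBW theorem: it suffices to exhibit some module with
$p$-character $\chi$ and a nonzero highest weight vector of weight $\lambda$ (`gen_ne_zero`).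
Weights and $p$-characters add under tensor products (`HasHighestWeight.add`), so only small
building blocks are needed. These come from the action of $gl(m|n)$ by $X_iD_j$ on truncated Fock
spaces of a Weyl superalgebra (`hasHighestWeight_fock`). Because $\chi(H)=0$, the coordinates of
$\lambda$ lie in the prime field and are reached by integer combinations of weights. The relation
$x^p-x^{[p]}=\chi(x)^p$ passes from matrix units to all even $x$ by Jacobson's formula. -/

/-! ### Jacobson's formula for $p$-th powers of sums -/

theorem choose_pred_prime_cast {R : Type*} [Ring R] (p : ℕ) [hp : Fact p.Prime] [CharP R p]
    {k : ℕ} (hk : k < p) : (((p - 1).choose k : ℕ) : R) = (-1) ^ k := by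
  induction k with
  | zero => simp
  | succ k ih =>
    have h1 := Nat.choose_succ_succ (p - 1) k
    rw [Nat.succ_eq_add_one, Nat.sub_add_cancel hp.out.one_le] at h1
    have h2 : ((p.choose (k + 1) : ℕ) : R) = 0 := by
      rw [CharP.cast_eq_zero_iff R p]
      exact hp.out.dvd_choose_self (by omega) hk
    rw [h1, Nat.cast_add, ih (by omega)] at h2
    rw [pow_succ, mul_neg_one, eq_neg_iff_add_eq_zero, add_comm]
    exact h2

/-- In characteristic `p`, `(x - y)^(p-1) = ∑ x^k y^(p-1-k)` for commuting `x`, `y`. -/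
theorem Commute.sub_pow_pred_prime {R : Type*} [Ring R] (p : ℕ) [hp : Fact p.Prime] [CharP R p]
    {x y : R} (h : Commute x y) :
    (x - y) ^ (p - 1) = ∑ k ∈ Finset.range p, x ^ k * y ^ (p - 1 - k) := by
  have hc : Commute x (-y) := h.neg_right
  rw [sub_eq_add_neg, hc.add_pow, Nat.sub_add_cancel hp.out.one_le]
  refine Finset.sum_congr rfl fun k hk => ?_
  have hk' : k < p := Finset.mem_range.1 hk
  have e : k + (p - 1 - k) = p - 1 := by omega
  rw [choose_pred_prime_cast p hk', neg_pow y, mul_assoc, mul_assoc]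
  have hcm : Commute (y ^ (p - 1 - k)) ((-1 : R) ^ k) := ((Commute.one_right _).neg_right).pow_right _
  rw [hcm.eq, ← mul_assoc ((-1 : R) ^ (p - 1 - k)), ← pow_add, Nat.sub_add_cancel (by omega)]
  have : ((-1 : R)) ^ (p - 1) = 1 := by
    have h1 := choose_pred_prime_cast (R := R) p (k := p - 1) (by have := hp.out.pos; omega)
    rw [← h1]; simp
  rw [this, one_mul]

open Polynomial in
theorem Polynomial.derivative_pow_eq_sum {R : Type*} [Ring R] (u : Polynomial R) (n : ℕ) :
    derivative (u ^ n) = ∑ k ∈ Finset.range n, u ^ k * derivative u * u ^ (n - 1 - k) := by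
  induction n with
  | zero => simp
  | succ n ih =>
    rw [pow_succ, derivative_mul, ih, Finset.sum_range_succ, Finset.sum_mul]
    congr 1
    · refine Finset.sum_congr rfl fun k hk => ?_
      have := Finset.mem_range.1 hk
      rw [mul_assoc, ← pow_succ]
      congr 2; omega
    · simp

open Polynomial in
/-- Jacobson's formula, in the form: if a subspace `Γ` of an associative algebra of characteristic
`p` is closed under commutators, then `(x + y)^p - x^p - y^p` lies in `Γ` for `x`, `y` in `Γ`. -/
theorem add_pow_sub_pow_sub_pow_mem {F S : Type*} [Field F] [Ring S] [Algebra F S]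
    (p : ℕ) [hp : Fact p.Prime] [CharP F p] [CharP S p] (Γ : Submodule F S)
    (hΓ : ∀ x ∈ Γ, ∀ y ∈ Γ, x * y - y * x ∈ Γ) {x y : S} (hx : x ∈ Γ) (hy : y ∈ Γ) :
    (x + y) ^ p - x ^ p - y ^ p ∈ Γ := by
  -- The plan is to expand $u^p$ for $u=xX+y$. Its derivative is $\sum_k u^k x
  -- u^{p-1-k}=(\mathrm{ad}\,u)^{p-1}(x)$, which has coefficients in `Γ`; so do the middle
  -- coefficients of $u^p$, and setting $X=1$ gives the claim.
  let P : Set S[X] := {f | ∀ k, f.coeff k ∈ Γ}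
  have hP : ∀ f ∈ P, ∀ g ∈ P, f * g - g * f ∈ P := by
    intro f hf g hg k
    rw [coeff_sub, coeff_mul, coeff_mul,
      ← Finset.Nat.sum_antidiagonal_swap (f := fun i => g.coeff i.1 * f.coeff i.2),
      ← Finset.sum_sub_distrib]
    exact Submodule.sum_mem _ fun i _ => hΓ _ (hf _) _ (hg _)
  let u : S[X] := C x * X + C y
  have hu : u ∈ P := by
    intro k
    simp only [u, coeff_add, coeff_C, coeff_C_mul, coeff_X]
    split_ifs <;> simp [hx, hy, Γ.add_mem]
  have hdu : derivative u = C x := by simp [u]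
  have had : ∀ j : ℕ, (((LinearMap.mulLeft ℤ u - LinearMap.mulRight ℤ u) ^ j) (C x)) ∈ P := by
    intro j
    induction j with
    | zero =>
      intro k
      rw [pow_zero, Module.End.one_apply, coeff_C]
      split_ifs <;> simp [hx]
    | succ j ih =>
      rw [pow_succ', Module.End.mul_apply]
      exact hP u hu _ ih
  have hchar : CharP (Module.End ℤ S[X]) p := by
    constructor
    intro k
    rw [← CharP.cast_eq_zero_iff S[X] p k]
    constructor
    · intro h
      have := LinearMap.congr_fun h (1 : S[X])
      simpa using this
    · intro h
      ext1 f
      simp [h]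
  have hder : derivative (u ^ p) ∈ P := by
    -- Left and right multiplication by `u` commute, so the power of their difference expands into
    -- the sum that occurs in the derivative.
    have h1 := LinearMap.congr_fun (Commute.sub_pow_pred_prime p
      (LinearMap.commute_mulLeft_right (R := ℤ) u u)) (C x)
    have h2 := had (p - 1)
    rw [h1] at h2
    rw [derivative_pow_eq_sum, hdu]
    convert h2 using 1
    rw [LinearMap.sum_apply]
    refine Finset.sum_congr rfl fun k _ => ?_
    rw [Module.End.mul_apply, LinearMap.pow_mulLeft, LinearMap.pow_mulRight]
    simp [mul_assoc]
  have hco : ∀ k, k ≠ 0 → k < p → (u ^ p).coeff k ∈ Γ := by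
    intro k hk hkp
    obtain ⟨k, rfl⟩ := Nat.exists_eq_succ_of_ne_zero hk
    have h1 := hder k
    rw [coeff_derivative] at h1
    -- The derivative multiplies the coefficient of degree `k + 1` by `k + 1`, which is invertible
    -- below degree `p`.
    have hne : ((k + 1 : ℕ) : F) ≠ 0 := by
      rw [Ne, CharP.cast_eq_zero_iff F p]
      exact fun h => absurd (Nat.le_of_dvd (by omega) h) (by omega)
    have h2 : (u ^ p).coeff (k + 1) * ((k : S) + 1) = ((k + 1 : ℕ) : F) • (u ^ p).coeff (k + 1) := by
      rw [Algebra.smul_def, map_natCast, Nat.cast_comm]; push_cast; rfl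
    rw [h2] at h1
    exact (Γ.smul_mem_iff hne).1 h1
  have hdeg : u.natDegree ≤ 1 := by
    simp only [u]; compute_degree
  have hdegp : (u ^ p).natDegree < p + 1 :=
    lt_of_le_of_lt (natDegree_pow_le_of_le p hdeg) (by omega)
  let ev : S[X] →+* S := eval₂RingHom' (RingHom.id S) 1 fun a => Commute.one_right _
  have hev : (x + y) ^ p = ∑ k ∈ Finset.range (p + 1), (u ^ p).coeff k := by
    have h1 : ev u = x + y := by simp [ev, u, eval₂RingHom']
    rw [← h1, ← map_pow]
    change eval₂ (RingHom.id S) 1 (u ^ p) = _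
    rw [eval₂_eq_sum_range' _ hdegp]
    simp
  have h0 : (u ^ p).coeff 0 = y ^ p := by
    have h1 : constantCoeff u = y := by simp [u]
    rw [← constantCoeff_apply, map_pow, h1]
  have hpp : (u ^ p).coeff p = x ^ p := by
    have := coeff_pow_of_natDegree_le (m := p) hdeg
    rw [mul_one] at this
    rw [this]; simp [u, coeff_C]
  rw [hev, Finset.sum_range_succ, Finset.range_eq_Ico, Finset.sum_eq_sum_Ico_succ_bot hp.out.pos, h0, hpp]
  have : y ^ p + ∑ k ∈ Finset.Ico (0 + 1) p, (u ^ p).coeff k + x ^ p - x ^ p - y ^ p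
      = ∑ k ∈ Finset.Ico (0 + 1) p, (u ^ p).coeff k := by abel
  rw [this]
  refine Submodule.sum_mem _ fun k hk => hco k ?_ (Finset.mem_Ico.1 hk).2
  have := (Finset.mem_Ico.1 hk).1; omega

namespace SuperGL

/-! ### Signs -/

section Sign
variable (F : Type*) [Field F]

theorem eq_zero_or_eq_one_of_zmod_two (i : ZMod 2) : i = 0 ∨ i = 1 := by
  revert i; decide

@[simp] theorem sgn_zero_left (i : ZMod 2) : sgn F 0 i = 1 := by simp [sgn]

@[simp] theorem sgn_zero_right (i : ZMod 2) : sgn F i 0 = 1 := by simp [sgn]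

@[simp] theorem sgn_one_one : sgn F 1 1 = -1 := by simp [sgn, ZMod.val_one]

theorem sgn_comm (i j : ZMod 2) : sgn F i j = sgn F j i := by simp [sgn, mul_comm]

theorem sgn_mul_self (i j : ZMod 2) : sgn F i j * sgn F i j = 1 := by
  rcases eq_zero_or_eq_one_of_zmod_two i with rfl | rfl <;>
    rcases eq_zero_or_eq_one_of_zmod_two j with rfl | rfl <;> simp

theorem sgn_add_left (i j k : ZMod 2) : sgn F (i + j) k = sgn F i k * sgn F j k := by
  have h : (1 + 1 : ZMod 2) = 0 := rfl
  rcases eq_zero_or_eq_one_of_zmod_two i with rfl | rfl <;>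
    rcases eq_zero_or_eq_one_of_zmod_two j with rfl | rfl <;>
      rcases eq_zero_or_eq_one_of_zmod_two k with rfl | rfl <;> simp [h]

theorem sgn_add_right (i j k : ZMod 2) : sgn F i (j + k) = sgn F i j * sgn F i k := by
  rw [sgn_comm, sgn_add_left, sgn_comm F j, sgn_comm F k]

end Sign

/-! ### The Weyl superalgebra -/

section Weyl
variable {F : Type*} [Field F] {A : Type*} [Ring A] [Algebra F A] {σ : Type*} [DecidableEq σ]

/-- The relations of the Weyl superalgebra, in variables `X i` of parity `q i` and the
corresponding derivations `D i`. -/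
structure IsSuperWeyl (F : Type*) [Field F] {A : Type*} [Ring A] [Algebra F A]
    {σ : Type*} [DecidableEq σ] (q : σ → ZMod 2) (X D : σ → A) : Prop where
  XX : ∀ i j, X i * X j = sgn F (q i) (q j) • (X j * X i)
  DD : ∀ i j, D i * D j = sgn F (q i) (q j) • (D j * D i)
  DX : ∀ i j, D i * X j = sgn F (q i) (q j) • (X j * D i) + if i = j then 1 else 0

/-- The Fourier transform in the variables indexed by `P`. -/
theorem IsSuperWeyl.flip {q : σ → ZMod 2} {X D : σ → A} (h : IsSuperWeyl F q X D)
    (P : σ → Prop) [DecidablePred P] :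
    IsSuperWeyl F q (fun i => if P i then -sgn F (q i) (q i) • D i else X i)
      (fun i => if P i then X i else D i) := by
  constructor
  · intro i j
    by_cases hi : P i <;> by_cases hj : P j
    · simp only [hi, hj, if_true, smul_mul_smul_comm, h.DD i j, smul_smul]
      congr 1; ring
    · have hij : i ≠ j := by rintro rfl; exact hj hi
      simp only [hi, hj, if_true, if_false, smul_mul_assoc, mul_smul_comm, h.DX i j, hij, add_zero,
        smul_smul]
      congr 1; ring
    · have hij : j ≠ i := by rintro rfl; exact hi hj
      simp only [hi, hj, if_true, if_false, smul_mul_assoc, mul_smul_comm, h.DX j i, hij, add_zero,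
        smul_smul]
      congr 1
      rw [sgn_comm F (q j) (q i), mul_left_comm, sgn_mul_self, mul_one]
    · simp only [hi, hj, if_false, h.XX i j]
  · intro i j
    by_cases hi : P i <;> by_cases hj : P j
    · simp only [hi, hj, if_true, h.XX i j]
    · have hij : j ≠ i := by rintro rfl; exact hj hi
      simp only [hi, hj, if_true, if_false, h.DX j i, hij, add_zero, smul_smul]
      rw [sgn_comm F (q j) (q i), sgn_mul_self, one_smul]
    · have hij : i ≠ j := by rintro rfl; exact hi hj
      simp only [hi, hj, if_true, if_false, h.DX i j, hij, add_zero]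
    · simp only [hi, hj, if_false, h.DD i j]
  · intro i j
    by_cases hi : P i <;> by_cases hj : P j
    · simp only [hi, hj, if_true, smul_mul_assoc, mul_smul_comm, h.DX j i, smul_smul, smul_add]
      rw [sgn_comm F (q j) (q i)]
      by_cases hij : i = j
      · subst hij
        simp only [if_true, mul_neg, sgn_mul_self, neg_mul, neg_smul, one_smul, neg_add_cancel_right,
          mul_one]
      · rw [if_neg hij, if_neg (Ne.symm hij), smul_zero, add_zero, add_zero]
        congr 1
        linear_combination sgn F (q j) (q j) * sgn_mul_self F (q i) (q j)
    · have hij : i ≠ j := by rintro rfl; exact hj hi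
      simp only [hi, hj, if_true, if_false, hij, add_zero, h.XX i j]
    · have hij : i ≠ j := by rintro rfl; exact hi hj
      simp only [hi, hj, if_true, if_false, hij, add_zero, mul_smul_comm, smul_mul_assoc, h.DD i j]
      rw [smul_comm]
    · simp only [hi, hj, if_false, h.DX i j]

/-- `X i D j` satisfy the commutation relations of the matrix units of a general linear Lie
superalgebra. -/
theorem IsSuperWeyl.bracket {q : σ → ZMod 2} {X D : σ → A} (h : IsSuperWeyl F q X D)
    (i j k l : σ) :
    X i * D j * (X k * D l) - sgn F (q i + q j) (q k + q l) • (X k * D l * (X i * D j))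
      = (if j = k then X i * D l else 0)
        - sgn F (q i + q j) (q k + q l) • (if l = i then X k * D j else 0) := by
  have e : ∀ a b c d : σ, X a * D b * (X c * D d)
      = sgn F (q b) (q c) • (X a * X c * (D b * D d)) + if b = c then X a * D d else 0 := by
    intro a b c d
    have : X a * D b * (X c * D d) = X a * (D b * X c) * D d := by simp only [mul_assoc]
    rw [this, h.DX, mul_add, add_mul, mul_smul_comm, smul_mul_assoc]
    congr 1
    · simp only [mul_assoc]
    · split_ifs <;> simp
  rw [e i j k l, e k l i j, h.XX k i, h.DD l j]
  simp only [smul_add, smul_mul_assoc, mul_smul_comm, smul_smul]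
  have : sgn F (q i + q j) (q k + q l) * (sgn F (q l) (q i) * (sgn F (q l) (q j) * sgn F (q k) (q i)))
      = sgn F (q j) (q k) := by
    simp only [sgn_add_left, sgn_add_right]
    rw [sgn_comm F (q l) (q i), sgn_comm F (q l) (q j), sgn_comm F (q k) (q i)]
    linear_combination (sgn F (q j) (q k) * sgn F (q i) (q l) ^ 2 * sgn F (q j) (q l) ^ 2) *
      sgn_mul_self F (q i) (q k) + (sgn F (q j) (q k) * sgn F (q j) (q l) ^ 2) *
      sgn_mul_self F (q i) (q l) + sgn F (q j) (q k) * sgn_mul_self F (q j) (q l)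
  rw [this]
  abel

end Weyl

/-! ### Multiplication and differentiation on truncated polynomials -/

section Fock
universe u
variable {F : Type u} [Field F] (p : ℕ) [hp : Fact p.Prime] [CharP F p] {σ : Type}
  [DecidableEq σ]

/-- The image in `F` of a residue class modulo `p`. -/
abbrev residue (F : Type*) [Field F] (p : ℕ) [CharP F p] : ZMod p →+* F :=
  ZMod.castHom (dvd_refl p) F

/-- Multiplication by the variable `i` on truncated polynomials in which the `p`-th power of this
variable is `t`. -/
def shiftUp {E : Type*} [AddCommGroup E] [Module F E] (i : σ) (t : F) :
    Module.End F ((σ → ZMod p) → E) where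
  -- Exponents live in `ZMod p`. The coefficient at exponent 0 comes from wrapping around from
  -- exponent `p - 1`, and this is where the factor `t` enters.
  toFun f k := (if k i = 0 then t else 1) • f (k - Pi.single i 1)
  map_add' f g := by ext k; simp
  map_smul' c f := by ext k; simp only [Pi.smul_apply, RingHom.id_apply]; rw [smul_comm]

/-- The partial derivative in the variable `i` on truncated polynomials. -/
def shiftDown {E : Type*} [AddCommGroup E] [Module F E] (i : σ) :
    Module.End F ((σ → ZMod p) → E) where
  toFun f k := residue F p (k i + 1) • f (k + Pi.single i 1)
  map_add' f g := by ext k; simp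
  map_smul' c f := by ext k; simp only [Pi.smul_apply, RingHom.id_apply]; rw [smul_comm]

variable {p}
variable {E : Type*} [AddCommGroup E] [Module F E]

omit [CharP F p] in
@[simp] theorem shiftUp_apply (i : σ) (t : F) (f : (σ → ZMod p) → E) (k : σ → ZMod p) :
    shiftUp p i t f k = (if k i = 0 then t else 1) • f (k - Pi.single i 1) := rfl

@[simp] theorem shiftDown_apply (i : σ) (f : (σ → ZMod p) → E) (k : σ → ZMod p) :
    shiftDown (F := F) p i f k = residue F p (k i + 1) • f (k + Pi.single i 1) := rfl

omit [CharP F p] in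
theorem shiftUp_pow_apply (i : σ) (t : F) (N : ℕ) (f : (σ → ZMod p) → E) (k : σ → ZMod p) :
    ((shiftUp p i t) ^ N) f k
      = (∏ j ∈ Finset.range N, if k i = (j : ZMod p) then t else 1) • f (k - Pi.single i (N : ZMod p)) := by
  induction N generalizing f with
  | zero => simp
  | succ N ih =>
    rw [pow_succ, Module.End.mul_apply, ih, shiftUp_apply, Finset.prod_range_succ, smul_smul]
    congr 2
    · simp [sub_eq_zero]
    · rw [sub_sub, ← Pi.single_add, Nat.cast_add, Nat.cast_one]

omit [CharP F p] in
theorem shiftUp_pow (i : σ) (t : F) : (shiftUp (E := E) p i t) ^ p = t • 1 := by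
  -- In `p` successive shifts each exponent wraps around exactly once.
  refine LinearMap.ext fun f => funext fun k => ?_
  rw [shiftUp_pow_apply]
  have h : (∏ j ∈ Finset.range p, if k i = (j : ZMod p) then t else 1) = t := by
    rw [Finset.prod_eq_single (k i).val]
    · simp
    · intro j hj hne
      rw [if_neg]
      intro h
      apply hne
      rw [h, ZMod.val_natCast, Nat.mod_eq_of_lt (Finset.mem_range.1 hj)]
    · intro h
      exact absurd (Finset.mem_range.2 (ZMod.val_lt _)) h
  simp [h]

theorem shiftDown_pow_apply (i : σ) (N : ℕ) (f : (σ → ZMod p) → E) (k : σ → ZMod p) :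
    ((shiftDown (F := F) p i) ^ N) f k
      = (∏ j ∈ Finset.range N, residue F p (k i + 1 + j)) • f (k + Pi.single i (N : ZMod p)) := by
  induction N generalizing f with
  | zero => simp
  | succ N ih =>
    rw [pow_succ, Module.End.mul_apply, ih, shiftDown_apply, Finset.prod_range_succ, smul_smul]
    congr 2
    · simp [add_right_comm]
    · rw [add_assoc, ← Pi.single_add, Nat.cast_add, Nat.cast_one]

theorem shiftDown_pow (i : σ) : (shiftDown (F := F) (E := E) p i) ^ p = 0 := by
  refine LinearMap.ext fun f => funext fun k => ?_
  -- The coefficients run through all residues, so one of them is zero.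
  rw [shiftDown_pow_apply, Finset.prod_eq_zero (i := (-(k i + 1)).val), zero_smul]
  · rfl
  · exact Finset.mem_range.2 (ZMod.val_lt _)
  · rw [ZMod.natCast_val, ZMod.cast_id, add_neg_cancel, map_zero]

theorem shiftUp_mul_shiftDown_apply (i : σ) (t : F) (f : (σ → ZMod p) → E) (k : σ → ZMod p) :
    (shiftUp p i t * shiftDown p i : Module.End F _) f k = residue F p (k i) • f k := by
  rw [Module.End.mul_apply, shiftUp_apply, shiftDown_apply, smul_smul]
  congr 1
  · split_ifs with h <;> simp [h]
  · simp

/-- The Euler operator is diagonal with eigenvalues in the prime field, which Frobenius fixes. -/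
theorem shiftUp_mul_shiftDown_pow (i : σ) (t : F) :
    (shiftUp (E := E) p i t * shiftDown p i) ^ p = shiftUp p i t * shiftDown p i := by
  have h : ∀ (N : ℕ) (f : (σ → ZMod p) → E) (k : σ → ZMod p),
      ((shiftUp p i t * shiftDown p i : Module.End F _) ^ N) f k = residue F p (k i ^ N) • f k := by
    intro N
    induction N with
    | zero => intro f k; simp
    | succ N ih =>
      intro f k
      rw [pow_succ, Module.End.mul_apply, ih, shiftUp_mul_shiftDown_apply, smul_smul, ← map_mul,
        ← pow_succ]
  refine LinearMap.ext fun f => funext fun k => ?_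
  rw [h, shiftUp_mul_shiftDown_apply, ZMod.pow_card]

omit [CharP F p] in
theorem shiftUp_comm {i j : σ} (hij : i ≠ j) (t t' : F) :
    shiftUp (E := E) p i t * shiftUp p j t' = shiftUp p j t' * shiftUp p i t := by
  refine LinearMap.ext fun f => funext fun k => ?_
  simp only [Module.End.mul_apply, shiftUp_apply, Pi.sub_apply, Pi.single_eq_of_ne hij,
    Pi.single_eq_of_ne (Ne.symm hij), sub_zero]
  rw [smul_comm, sub_right_comm]

theorem shiftDown_comm (i j : σ) :
    shiftDown (F := F) (E := E) p i * shiftDown p j = shiftDown p j * shiftDown p i := by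
  by_cases hij : i = j
  · rw [hij]
  refine LinearMap.ext fun f => funext fun k => ?_
  simp only [Module.End.mul_apply, shiftDown_apply, Pi.add_apply, Pi.single_eq_of_ne hij,
    Pi.single_eq_of_ne (Ne.symm hij), add_zero]
  rw [smul_comm, add_right_comm]

theorem shiftDown_shiftUp_comm {i j : σ} (hij : i ≠ j) (t : F) :
    shiftDown (E := E) p i * shiftUp p j t = shiftUp p j t * shiftDown p i := by
  refine LinearMap.ext fun f => funext fun k => ?_
  simp only [Module.End.mul_apply, shiftDown_apply, shiftUp_apply, Pi.add_apply, Pi.sub_apply,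
    Pi.single_eq_of_ne hij, Pi.single_eq_of_ne (Ne.symm hij), add_zero, sub_zero]
  rw [smul_comm, add_sub_right_comm]

theorem shiftDown_mul_shiftUp (i : σ) (t : F) :
    shiftDown (E := E) p i * shiftUp p i t = shiftUp p i t * shiftDown p i + 1 := by
  refine LinearMap.ext fun f => funext fun k => ?_
  rw [LinearMap.add_apply, Pi.add_apply, shiftUp_mul_shiftDown_apply]
  simp only [Module.End.mul_apply, shiftDown_apply, shiftUp_apply, Pi.add_apply,
    Pi.single_eq_same, add_sub_cancel_right, Module.End.one_apply, smul_smul]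
  -- At the wrap-around the factor `t` is harmless, because the derivative contributes the
  -- coefficient zero there.
  have : residue F p (k i + 1) * (if k i + 1 = 0 then t else 1) = residue F p (k i) + 1 := by
    split_ifs with h
    · rw [h, map_zero, zero_mul, ← map_one (residue F p), ← map_add, h, map_zero]
    · rw [mul_one, map_add, map_one]
  rw [this, add_smul, one_smul]

omit [CharP F p] in
theorem compLeft_shiftUp_comm (C : Module.End F E) (i : σ) (t : F) :
    (C.compLeft (σ → ZMod p) : Module.End F _) * shiftUp p i t = shiftUp p i t * (C.compLeft (σ → ZMod p) : Module.End F _) := by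
  refine LinearMap.ext fun f => funext fun k => ?_
  simp only [Module.End.mul_apply, LinearMap.compLeft_apply, Function.comp_apply, shiftUp_apply, map_smul]

theorem compLeft_shiftDown_comm (C : Module.End F E) (i : σ) :
    (C.compLeft (σ → ZMod p) : Module.End F _) * shiftDown p i = shiftDown p i * (C.compLeft (σ → ZMod p) : Module.End F _) := by
  refine LinearMap.ext fun f => funext fun k => ?_
  simp [Module.End.mul_apply]

end Fock

end SuperGL

noncomputable section
namespace SuperGL

/-! ### Fock spaces with even and odd variables -/

section Fock
universe u
variable {F : Type u} [Field F] {p : ℕ} [hp : Fact p.Prime] [CharP F p] {σ : Type}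
  [DecidableEq σ]

/-- The odd half of the Fock space: the exterior algebra, as the Clifford algebra of the zero form,
with left multiplications, contractions and the grade involution; the vacuum is 1. -/
theorem exists_clifford (F : Type u) [Field F] (σ : Type) [DecidableEq σ] :
    ∃ (E : Type u) (_ : AddCommGroup E) (_ : Module F E) (a b : σ → Module.End F E)
      (g : Module.End F E) (v : E), v ≠ 0 ∧ g * g = 1 ∧
      (∀ i j, a i * a j = (-1 : F) • (a j * a i)) ∧ (∀ i j, b i * b j = (-1 : F) • (b j * b i)) ∧
      (∀ i j, b i * a j = (-1 : F) • (a j * b i) + if i = j then 1 else 0) ∧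
      (∀ i, g * a i = (-1 : F) • (a i * g)) ∧ (∀ i, g * b i = (-1 : F) • (b i * g)) ∧
      ∀ i, b i v = 0 := by
  let Q : QuadraticForm F (σ → F) := 0
  let a : σ → Module.End F (CliffordAlgebra Q) :=
    fun i => LinearMap.mulLeft F (CliffordAlgebra.ι Q (Pi.single i 1))
  let b : σ → Module.End F (CliffordAlgebra Q) := fun i => CliffordAlgebra.contractLeft (LinearMap.proj i)
  let g : Module.End F (CliffordAlgebra Q) := (CliffordAlgebra.involute (Q := Q)).toLinearMap
  have : Nontrivial (CliffordAlgebra Q) := inferInstanceAs (Nontrivial (ExteriorAlgebra F (σ → F)))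
  refine ⟨CliffordAlgebra Q, inferInstance, inferInstance, a, b, g, 1, one_ne_zero,
    LinearMap.ext fun x => CliffordAlgebra.involute_involute x, ?_, ?_, ?_, ?_, ?_,
    fun i => CliffordAlgebra.contractLeft_one Q (LinearMap.proj i)⟩
  · intro i j
    refine LinearMap.ext fun x => ?_
    have h : CliffordAlgebra.ι Q (Pi.single i 1) * CliffordAlgebra.ι Q (Pi.single j 1)
        + CliffordAlgebra.ι Q (Pi.single j 1) * CliffordAlgebra.ι Q (Pi.single i 1) = 0 :=
      ExteriorAlgebra.ι_add_mul_swap (R := F) (Pi.single i 1 : σ → F) (Pi.single j 1)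
    simp only [a, Module.End.mul_apply, LinearMap.mulLeft_apply, LinearMap.neg_apply, ← mul_assoc,
      eq_neg_of_add_eq_zero_left h, neg_smul, one_smul]
    rw [neg_mul]
  · intro i j
    refine LinearMap.ext fun x => ?_
    simp only [b, Module.End.mul_apply, LinearMap.neg_apply, neg_smul, one_smul]
    exact CliffordAlgebra.contractLeft_comm _ _ x
  · intro i j
    refine LinearMap.ext fun x => ?_
    simp only [a, b, Module.End.mul_apply, LinearMap.neg_apply, LinearMap.add_apply,
      LinearMap.mulLeft_apply, neg_smul, one_smul, CliffordAlgebra.contractLeft_ι_mul]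
    rw [sub_eq_neg_add]
    congr 1
    by_cases hij : i = j
    · subst hij; simp
    · simp [hij]
  · intro i
    refine LinearMap.ext fun x => ?_
    simp only [g, a, Module.End.mul_apply, LinearMap.mulLeft_apply, LinearMap.neg_apply,
      AlgHom.toLinearMap_apply, map_mul, neg_smul, one_smul, CliffordAlgebra.involute_ι]
    rw [neg_mul]
  · intro i
    refine LinearMap.ext fun x => ?_
    induction x using CliffordAlgebra.left_induction with
    | algebraMap c =>
      simp only [Module.End.mul_apply, neg_smul, one_smul, LinearMap.neg_apply, b, g, AlgHom.toLinearMap_apply,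
        AlgHom.commutes, CliffordAlgebra.contractLeft_algebraMap, map_zero, neg_zero]
    | add x y hx hy => rw [map_add, hx, hy, map_add]
    | ι_mul x m hx =>
      simp only [Module.End.mul_apply, LinearMap.neg_apply, b, g, AlgHom.toLinearMap_apply,
        map_mul, CliffordAlgebra.contractLeft_ι_mul, CliffordAlgebra.involute_ι, map_sub, map_smul,
        neg_mul, map_neg, neg_smul, one_smul] at hx ⊢
      rw [hx]
      simp

/-- The space consists of functions on exponents with values in an exterior algebra: variables with
`q i = 0` act by shifts of exponents, the others on the values. `γ` supplies the signs of odd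
operators, and `v` is the constant polynomial 1. The parameters `t i` will produce nonzero
$p$-characters. -/
theorem exists_fock (q : σ → ZMod 2) (t : σ → F) :
    ∃ (M : Type u) (_ : AddCommGroup M) (_ : Module F M) (Y D : σ → Module.End F M)
      (γ : Module.End F M) (v : M), v ≠ 0 ∧ γ * γ = 1 ∧ IsSuperWeyl F q Y D ∧
      (∀ i, γ * Y i = sgn F 1 (q i) • (Y i * γ)) ∧ (∀ i, γ * D i = sgn F 1 (q i) • (D i * γ)) ∧
      (∀ i, D i v = 0) ∧
      ∀ i, q i = 0 → Y i ^ p = t i • 1 ∧ D i ^ p = 0 ∧ (Y i * D i) ^ p = Y i * D i := by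
  obtain ⟨E, _, _, a, b, g, v₀, hv₀, hgg, haa, hbb, hba, hga, hgb, hv⟩ := exists_clifford F σ
  let K := σ → ZMod p
  have : DecidableEq K := Classical.decEq K
  let C : Module.End F E → Module.End F (K → E) := fun f => f.compLeft K
  have Cmul : ∀ f g, C f * C g = C (f * g) := fun f g => rfl
  have Csmul : ∀ (a : F) f, a • C f = C (a • f) := fun a f => rfl
  have Cadd : ∀ f g, C f + C g = C (f + g) := fun f g => rfl
  have Cone : C 1 = 1 := rfl
  have Czero : C 0 = 0 := rfl
  let Y : σ → Module.End F (K → E) := fun i => if q i = 0 then shiftUp p i (t i) else C (a i)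
  let D : σ → Module.End F (K → E) := fun i => if q i = 0 then shiftDown p i else C (b i)
  have hY0 : ∀ {i}, q i = 0 → Y i = shiftUp p i (t i) := fun h => if_pos h
  have hD0 : ∀ {i}, q i = 0 → D i = shiftDown p i := fun h => if_pos h
  have hY1 : ∀ {i}, q i = 1 → Y i = C (a i) := fun h => if_neg (by rw [h]; decide)
  have hD1 : ∀ {i}, q i = 1 → D i = C (b i) := fun h => if_neg (by rw [h]; decide)
  refine ⟨K → E, inferInstance, inferInstance, Y, D, C g, Pi.single 0 v₀, ?_, ?_, ⟨?_, ?_, ?_⟩,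
    ?_, ?_, ?_, ?_⟩
  · intro h
    have := congrFun h 0
    rw [Pi.single_eq_same, Pi.zero_apply] at this
    exact hv₀ this
  · rw [Cmul, hgg, Cone]
  · intro i j
    rcases eq_zero_or_eq_one_of_zmod_two (q i) with hi | hi <;>
      rcases eq_zero_or_eq_one_of_zmod_two (q j) with hj | hj <;> rw [hi, hj]
    · rw [hY0 hi, hY0 hj, sgn_zero_left, one_smul]
      by_cases hij : i = j
      · rw [hij]
      · exact shiftUp_comm hij _ _
    · rw [hY0 hi, hY1 hj, sgn_zero_left, one_smul]
      exact (compLeft_shiftUp_comm _ _ _).symm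
    · rw [hY1 hi, hY0 hj, sgn_zero_right, one_smul]
      exact compLeft_shiftUp_comm _ _ _
    · rw [hY1 hi, hY1 hj, sgn_one_one, Cmul, haa, Cmul, Csmul]
  · intro i j
    rcases eq_zero_or_eq_one_of_zmod_two (q i) with hi | hi <;>
      rcases eq_zero_or_eq_one_of_zmod_two (q j) with hj | hj <;> rw [hi, hj]
    · rw [hD0 hi, hD0 hj, sgn_zero_left, one_smul, shiftDown_comm]
    · rw [hD0 hi, hD1 hj, sgn_zero_left, one_smul]
      exact (compLeft_shiftDown_comm _ _).symm
    · rw [hD1 hi, hD0 hj, sgn_zero_right, one_smul]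
      exact compLeft_shiftDown_comm _ _
    · rw [hD1 hi, hD1 hj, sgn_one_one, Cmul, hbb, Cmul, Csmul]
  · intro i j
    rcases eq_zero_or_eq_one_of_zmod_two (q i) with hi | hi <;>
      rcases eq_zero_or_eq_one_of_zmod_two (q j) with hj | hj
    · rw [hi, hj, hD0 hi, hY0 hj, sgn_zero_left, one_smul]
      by_cases hij : i = j
      · subst hij
        rw [if_pos rfl, shiftDown_mul_shiftUp]
      · rw [if_neg hij, add_zero, shiftDown_shiftUp_comm hij]
    · have hij : i ≠ j := by rintro rfl; rw [hi] at hj; exact absurd hj (by decide)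
      rw [hi, hj, hD0 hi, hY1 hj, sgn_zero_left, one_smul, if_neg hij, add_zero]
      exact (compLeft_shiftDown_comm _ _).symm
    · have hij : i ≠ j := by rintro rfl; rw [hi] at hj; exact absurd hj (by decide)
      rw [hi, hj, hD1 hi, hY0 hj, sgn_zero_right, one_smul, if_neg hij, add_zero]
      exact compLeft_shiftUp_comm _ _ _
    · rw [hi, hj, hD1 hi, hY1 hj, sgn_one_one, Cmul, hba, Cmul, Csmul, ← Cadd]
      congr 1
      split_ifs
      · exact Cone
      · exact Czero
  · intro i
    rcases eq_zero_or_eq_one_of_zmod_two (q i) with hi | hi <;> rw [hi]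
    · rw [hY0 hi, sgn_zero_right, one_smul]
      exact compLeft_shiftUp_comm _ _ _
    · rw [hY1 hi, sgn_one_one, Cmul, hga, Cmul, Csmul]
  · intro i
    rcases eq_zero_or_eq_one_of_zmod_two (q i) with hi | hi <;> rw [hi]
    · rw [hD0 hi, sgn_zero_right, one_smul]
      exact compLeft_shiftDown_comm _ _
    · rw [hD1 hi, sgn_one_one, Cmul, hgb, Cmul, Csmul]
  · intro i
    rcases eq_zero_or_eq_one_of_zmod_two (q i) with hi | hi
    · rw [hD0 hi]
      funext k
      rw [shiftDown_apply]
      by_cases hk : k + Pi.single i 1 = 0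
      · have : k i + 1 = 0 := by
          have := congrFun hk i
          rwa [Pi.add_apply, Pi.single_eq_same] at this
        rw [this, map_zero, zero_smul, Pi.zero_apply]
      · rw [Pi.single_eq_of_ne hk, smul_zero, Pi.zero_apply]
    · rw [hD1 hi]
      funext k
      change b i (Pi.single (M := fun _ : K => E) 0 v₀ k) = 0
      by_cases hk : k = 0
      · rw [hk, Pi.single_eq_same]
        exact hv i
      · rw [Pi.single_eq_of_ne hk, map_zero]
  · intro i hi
    rw [hY0 hi, hD0 hi]
    exact ⟨shiftUp_pow _ _, shiftDown_pow _, shiftUp_mul_shiftDown_pow _ _⟩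

end Fock
end SuperGL
end

noncomputable section
namespace SuperGL

/-! ### Highest weight vectors: tensor products and Fock spaces -/

section Modules
universe u
variable {F : Type u} [Field F] {p m n : ℕ}

/-- Operators `e a b` on `M` through which `gl(m|n)` acts with `p`-character
`χ(e_{ab}) = c a b`, compatibly with a parity operator `γ`. -/
structure IsReducedAction (p : ℕ) (c : Fin m ⊕ Fin n → Fin m ⊕ Fin n → F)
    {M : Type*} [AddCommGroup M] [Module F M]
    (e : Fin m ⊕ Fin n → Fin m ⊕ Fin n → Module.End F M) (γ : Module.End F M) : Prop where
  invol : γ * γ = 1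
  parity_comm : ∀ i j, γ * e i j = sgn F 1 (parity i + parity j) • (e i j * γ)
  bracket : ∀ i j k l,
    e i j * e k l - sgn F (parity i + parity j) (parity k + parity l) • (e k l * e i j)
      = (if j = k then e i l else 0)
        - sgn F (parity i + parity j) (parity k + parity l) • (if l = i then e k j else 0)
  pow : ∀ i j, parity i = parity j →
    e i j ^ p = (if i = j then e i j else 0) + (c i j) ^ p • 1

/-- There is a `gl(m|n)`-module with `p`-character `c` that contains a nonzero vector of weight
`w` annihilated by the positive root vectors. -/
def HasHighestWeight (p : ℕ) (r : Fin m ⊕ Fin n → Fin m ⊕ Fin n → Prop)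
    (c : Fin m ⊕ Fin n → Fin m ⊕ Fin n → F) (w : Fin m ⊕ Fin n → F) : Prop :=
  ∃ (M : Type u) (_ : AddCommGroup M) (_ : Module F M)
    (e : Fin m ⊕ Fin n → Fin m ⊕ Fin n → Module.End F M) (γ : Module.End F M) (v : M),
    IsReducedAction p c e γ ∧ v ≠ 0 ∧ (∀ i j, r i j → e i j v = 0) ∧ ∀ i, e i i v = w i • v

theorem charP_end (F : Type*) [Field F] (p : ℕ) [CharP F p] (M : Type*) [AddCommGroup M]
    [Module F M] [Nontrivial M] : CharP (Module.End F M) p :=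
  charP_of_injective_algebraMap (algebraMap F (Module.End F M)).injective p

variable [hp : Fact p.Prime] [CharP F p]

/-- An element $x$ acts by $x\otimes1+\gamma^{|x|}\otimes x$, where `γ` carries the sign rule. For
even $x$ the two summands commute, so their $p$-th powers add and the $p$-characters add as well. -/
theorem IsReducedAction.tensor {c c' : Fin m ⊕ Fin n → Fin m ⊕ Fin n → F}
    {M N : Type*} [AddCommGroup M] [Module F M] [AddCommGroup N] [Module F N]
    [Nontrivial M] [Nontrivial N]
    {e : Fin m ⊕ Fin n → Fin m ⊕ Fin n → Module.End F M} {γ : Module.End F M}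
    {e' : Fin m ⊕ Fin n → Fin m ⊕ Fin n → Module.End F N} {γ' : Module.End F N}
    (h : IsReducedAction p c e γ) (h' : IsReducedAction p c' e' γ') :
    IsReducedAction p (fun i j => c i j + c' i j)
      (fun i j => TensorProduct.map (e i j) 1
        + TensorProduct.map (if parity i + parity j = (0 : ZMod 2) then 1 else γ) (e' i j))
      (TensorProduct.map γ γ') := by
  have mm : ∀ (f f' : Module.End F M) (g g' : Module.End F N),
      TensorProduct.map f g * TensorProduct.map f' g' = TensorProduct.map (f * f') (g * g') :=
    fun f f' g g' => (TensorProduct.map_mul f f' g g').symm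
  have hγ : ∀ a b : ZMod 2, (if a = 0 then 1 else γ) * (if b = 0 then 1 else γ)
      = if a + b = 0 then 1 else γ := by
    intro a b
    have h2 : (1 + 1 : ZMod 2) = 0 := rfl
    rcases eq_zero_or_eq_one_of_zmod_two a with rfl | rfl <;>
      rcases eq_zero_or_eq_one_of_zmod_two b with rfl | rfl <;> simp [h2, h.invol]
  have map_sub_l : ∀ (f f' : Module.End F M) (g : Module.End F N),
      TensorProduct.map (f - f') g = TensorProduct.map f g - TensorProduct.map f' g :=
    fun f f' g => LinearMap.congr_fun (map_sub (TensorProduct.mapBilinear (RingHom.id F) M N M N) f f') g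
  have map_sub_r : ∀ (f : Module.End F M) (g g' : Module.End F N),
      TensorProduct.map f (g - g') = TensorProduct.map f g - TensorProduct.map f g' :=
    fun f g g' => map_sub (TensorProduct.mapBilinear (RingHom.id F) M N M N f) g g'
  have hγe : ∀ (a : ZMod 2) i j, (if a = 0 then 1 else γ) * e i j
      = sgn F a (parity i + parity j) • (e i j * if a = 0 then 1 else γ) := by
    intro a i j
    rcases eq_zero_or_eq_one_of_zmod_two a with rfl | rfl
    · simp
    · simpa using h.parity_comm i j
  constructor
  · rw [mm, h.invol, h'.invol, TensorProduct.map_one]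
  · intro i j
    have hg : γ * (if parity i + parity j = (0 : ZMod 2) then 1 else γ)
        = (if parity i + parity j = (0 : ZMod 2) then 1 else γ) * γ := by
      split_ifs <;> simp
    simp only [mul_add, add_mul, mm, smul_add, mul_one, one_mul, h.parity_comm, h'.parity_comm, hg,
      TensorProduct.map_smul_left, TensorProduct.map_smul_right]
  · intro i j k l
    have hb := h.bracket i j k l
    have hb' := h'.bracket i j k l
    generalize hs : sgn F (parity i + parity j) (parity k + parity l) = s at hb hb' ⊢
    have hss : s * s = 1 := by rw [← hs, sgn_mul_self]
    have hs' : sgn F (parity k + parity l) (parity i + parity j) = s := by rw [sgn_comm, hs]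
    simp only [mul_add, add_mul, mm, mul_one, one_mul]
    rw [hγe, hγe, hγ, hγ, hs, hs', add_comm (parity k + parity l) (parity i + parity j)]
    set a : ZMod 2 := parity i + parity j with ha
    set b : ZMod 2 := parity k + parity l with hb0
    -- The mixed terms cancel: moving `γ` past an operator of the first factor costs exactly the
    -- sign `s`, and `s * s = 1`.
    trans TensorProduct.map (e i j * e k l - s • (e k l * e i j)) (1 : Module.End F N)
      + TensorProduct.map (if a + b = 0 then 1 else γ) (e' i j * e' k l - s • (e' k l * e' i j))
    · simp only [map_sub_l, map_sub_r,
        TensorProduct.map_smul_left, TensorProduct.map_smul_right, smul_add, smul_smul, hss, one_smul]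
      abel
    · have h2 : ∀ x y z : ZMod 2, x + y + (y + z) = x + z := by decide
      have h3 : ∀ x y z : ZMod 2, x + y + (z + x) = z + y := by decide
      have e1 : TensorProduct.map (if j = k then e i l else 0) (1 : Module.End F N)
          + TensorProduct.map (if a + b = 0 then 1 else γ) (if j = k then e' i l else 0)
          = if j = k then TensorProduct.map (e i l) (1 : Module.End F N)
            + TensorProduct.map (if parity i + parity l = (0 : ZMod 2) then 1 else γ) (e' i l)
            else 0 := by
        by_cases hjk : j = k
        · rw [ha, hb0, if_pos hjk, if_pos hjk, if_pos hjk, hjk, h2]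
        · simp [if_neg hjk]
      have e2 : TensorProduct.map (if l = i then e k j else 0) (1 : Module.End F N)
          + TensorProduct.map (if a + b = 0 then 1 else γ) (if l = i then e' k j else 0)
          = if l = i then TensorProduct.map (e k j) (1 : Module.End F N)
            + TensorProduct.map (if parity k + parity j = (0 : ZMod 2) then 1 else γ) (e' k j)
            else 0 := by
        by_cases hli : l = i
        · rw [ha, hb0, if_pos hli, if_pos hli, if_pos hli, hli, h3]
        · simp [if_neg hli]
      rw [hb, hb', ← e1, ← e2]
      simp only [map_sub_l, map_sub_r,
        TensorProduct.map_smul_left, TensorProduct.map_smul_right, smul_add]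
      abel
  · intro i j hij
    have h0 : (parity i + parity j : ZMod 2) = 0 := by
      rw [hij]; rcases eq_zero_or_eq_one_of_zmod_two (parity j : ZMod 2) with h | h <;> rw [h] <;> rfl
    have : CharP (Module.End F (M ⊗[F] N)) p := charP_end F p _
    have hc : Commute (TensorProduct.map (e i j) (1 : Module.End F N))
        (TensorProduct.map (1 : Module.End F M) (e' i j)) := by
      rw [commute_iff_eq, mm, mm]; simp
    rw [if_pos h0, add_pow_char_of_commute _ hc, TensorProduct.map_pow, TensorProduct.map_pow,
      one_pow, one_pow, h.pow i j hij, h'.pow i j hij, add_pow_char]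
    by_cases e : i = j
    · simp only [if_pos e, TensorProduct.map_add_left, TensorProduct.map_add_right,
        TensorProduct.map_smul_left, TensorProduct.map_smul_right, TensorProduct.map_one, add_smul]
      abel
    · simp only [if_neg e, zero_add,
        TensorProduct.map_smul_left, TensorProduct.map_smul_right, TensorProduct.map_one, add_smul]

theorem HasHighestWeight.add {r : Fin m ⊕ Fin n → Fin m ⊕ Fin n → Prop}
    [IsStrictTotalOrder (Fin m ⊕ Fin n) r]
    {c c' : Fin m ⊕ Fin n → Fin m ⊕ Fin n → F} {w w' : Fin m ⊕ Fin n → F}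
    (h : HasHighestWeight p r c w) (h' : HasHighestWeight p r c' w') :
    HasHighestWeight p r (c + c') (w + w') := by
  obtain ⟨M, _, _, e, γ, v, he, hv, hpos, hw⟩ := h
  obtain ⟨N, _, _, e', γ', v', he', hv', hpos', hw'⟩ := h'
  have : Nontrivial M := ⟨v, 0, hv⟩
  have : Nontrivial N := ⟨v', 0, hv'⟩
  refine ⟨M ⊗[F] N, inferInstance, inferInstance, _, _, v ⊗ₜ v', he.tensor he', ?_, ?_, ?_⟩
  · intro h
    obtain ⟨f, hf⟩ := Module.Projective.exists_dual_ne_zero F hv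
    obtain ⟨g, hg⟩ := Module.Projective.exists_dual_ne_zero F hv'
    have := congrArg (TensorProduct.dualDistrib F M N (f ⊗ₜ g)) h
    rw [TensorProduct.dualDistrib_apply, map_zero] at this
    exact mul_ne_zero hf hg this
  · intro i j hij
    rw [LinearMap.add_apply, TensorProduct.map_tmul, TensorProduct.map_tmul, hpos i j hij,
      hpos' i j hij, TensorProduct.zero_tmul, TensorProduct.tmul_zero, add_zero]
  · intro i
    have h0 : (parity i + parity i : ZMod 2) = 0 := by
      rcases eq_zero_or_eq_one_of_zmod_two (parity i : ZMod 2) with h | h <;> rw [h] <;> rfl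
    rw [LinearMap.add_apply, TensorProduct.map_tmul, TensorProduct.map_tmul, if_pos h0, hw, hw',
      Module.End.one_apply, Module.End.one_apply, TensorProduct.tmul_smul, ← TensorProduct.smul_tmul',
      ← add_smul, Pi.add_apply]

/-- A truncated Fock space, Fourier transformed in the variables that belong to the initial
segment `P` of the order. -/
theorem hasHighestWeight_fock (hp2 : 2 < p) {r : Fin m ⊕ Fin n → Fin m ⊕ Fin n → Prop}
    [IsStrictTotalOrder (Fin m ⊕ Fin n) r] (P : Fin m ⊕ Fin n → Prop) [DecidablePred P]
    (hP : ∀ i j, r i j → P j → P i) (s : ZMod 2) (t : Fin m ⊕ Fin n → F)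
    (c : Fin m ⊕ Fin n → Fin m ⊕ Fin n → F)
    (hc : ∀ i j, parity i = parity j → c i j ^ p =
      if ¬ P i ∧ P j ∧ parity i + s = (0 : ZMod 2) then t i * t j else 0) :
    HasHighestWeight p r c
      (fun i => if P i then -sgn F (parity i + s) (parity i + s) else 0) := by
  -- The shift `s` chooses which indices carry even variables. It does not change the parity of
  -- $X_iD_j$.
  let q : Fin m ⊕ Fin n → ZMod 2 := fun i => parity i + s
  obtain ⟨M, _, _, Y, D, γ, v, hv, hγ, hW, hY, hD, hDv, hpow⟩ := exists_fock (p := p) q t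
  have hWf := hW.flip P
  set X' : Fin m ⊕ Fin n → Module.End F M :=
    fun i => if P i then -sgn F (q i) (q i) • D i else Y i with hX'
  set D' : Fin m ⊕ Fin n → Module.End F M := fun i => if P i then Y i else D i with hD'
  have hq : ∀ i j, q i + q j = parity i + parity j := by
    have : ∀ x y z : ZMod 2, x + z + (y + z) = x + y := by decide
    exact fun i j => this _ _ _
  have hXp : ∀ {i}, P i → X' i = -sgn F (q i) (q i) • D i := fun h => if_pos h
  have hXn : ∀ {i}, ¬ P i → X' i = Y i := fun h => if_neg h
  have hDp : ∀ {i}, P i → D' i = Y i := fun h => if_pos h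
  have hDn : ∀ {i}, ¬ P i → D' i = D i := fun h => if_neg h
  have hXv : ∀ {i}, P i → X' i v = 0 := fun h => by rw [hXp h, LinearMap.smul_apply, hDv, smul_zero]
  have hDv' : ∀ {i}, ¬ P i → D' i v = 0 := fun h => by rw [hDn h, hDv]
  have : Nontrivial M := ⟨v, 0, hv⟩
  have : CharP (Module.End F M) p := charP_end F p M
  have h2 : (2 : F) ≠ 0 := by
    have := (CharP.cast_eq_zero_iff F p 2).not.2 (fun h => absurd (Nat.le_of_dvd (by omega) h) (by omega))
    exact_mod_cast this
  have hpodd : Odd p := hp.out.odd_of_ne_two (by omega)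
  have hself : ∀ x : Module.End F M, x = (-1 : F) • x → x = 0 := by
    intro x hx
    have : (2 : F) • x = 0 := by rw [two_smul]; nth_rewrite 1 [hx]; simp
    exact (smul_eq_zero.1 this).resolve_left h2
  refine ⟨M, inferInstance, inferInstance, fun i j => X' i * D' j, γ, v, ⟨hγ, ?_, ?_, ?_⟩, hv, ?_, ?_⟩
  · have hX1 : ∀ i, γ * X' i = sgn F 1 (q i) • (X' i * γ) := by
      intro i
      by_cases h : P i
      · rw [hXp h, mul_smul_comm, hD, smul_mul_assoc, smul_comm]
      · rw [hXn h, hY]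
    have hD1 : ∀ i, γ * D' i = sgn F 1 (q i) • (D' i * γ) := by
      intro i
      by_cases h : P i
      · rw [hDp h, hY]
      · rw [hDn h, hD]
    intro i j
    rw [← mul_assoc, hX1, smul_mul_assoc, mul_assoc, hD1, mul_smul_comm, smul_smul, ← mul_assoc,
      ← sgn_add_right, hq]
  · intro i j k l
    have := hWf.bracket i j k l
    rwa [hq, hq] at this
  -- For even variables with $i\neq j$, $X_i$ and $D_j$ commute and $(X_iD_j)^p$ is a product of
  -- $p$-th powers. It is nonzero only if both factors are multiplications, i.e. $i\notin P$ and
  -- $j\in P$, and then equals $t_it_j$. For $i=j$ the operator is an Euler operator or minus its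
  -- successor.
  · intro i j hij
    rw [hc i j hij]
    have hqij : q i = q j := by simp only [q, hij]
    change _ = _ + (if ¬ P i ∧ P j ∧ q i = 0 then t i * t j else 0) • (1 : Module.End F M)
    rcases eq_zero_or_eq_one_of_zmod_two (q i) with hi | hi
    · have hj : q j = 0 := by rw [← hqij, hi]
      have hDi : (-sgn F (q i) (q i) • D i) ^ p = 0 := by
        rw [smul_pow, (hpow i hi).2.1, smul_zero]
      by_cases e : i = j
      · subst e
        rw [if_pos rfl, if_neg (fun h => h.1 h.2.1), zero_smul, add_zero]
        by_cases h : P i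
        · have : X' i * D' i = -(Y i * D i + 1) := by
            rw [hXp h, hDp h, smul_mul_assoc, hW.DX, hi, if_pos rfl]; simp [add_comm]
          rw [this, hpodd.neg_pow, add_pow_char_of_commute _ (Commute.one_right _),
            (hpow i hi).2.2, one_pow]
        · rw [hXn h, hDn h, (hpow i hi).2.2]
      · have hcomm : Commute (X' i) (D' j) := by
          have := hWf.DX j i
          rw [hi, hj, sgn_zero_left, one_smul, if_neg (Ne.symm e), add_zero] at this
          exact this.symm
        rw [if_neg e, zero_add, hcomm.mul_pow]
        by_cases h : P i
        · rw [hXp h, hDi, zero_mul, if_neg (fun h' => h'.1 h), zero_smul]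
        · by_cases h' : P j
          · rw [if_pos ⟨h, h', hi⟩, hXn h, hDp h', (hpow i hi).1, (hpow j hj).1, smul_mul_smul_comm,
              one_mul]
          · rw [if_neg (fun h'' => h' h''.2.1), hDn h', (hpow j hj).2.1, mul_zero, zero_smul]
    · have hj : q j = 1 := by rw [← hqij, hi]
      rw [if_neg (c := ¬ P i ∧ P j ∧ q i = 0)
        (fun h => by have := h.2.2; rw [hi] at this; exact absurd this (by decide)), zero_smul, add_zero]
      have hXX : X' i * X' i = 0 := hself _ (by
        have := hWf.XX i i
        rwa [hi, sgn_one_one] at this)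
      have hDX := hWf.DX j i
      rw [hi, hj, sgn_one_one, neg_smul, one_smul] at hDX
      -- For odd variables $X_iD_j$ is idempotent or of square zero.
      have hsq : (X' i * D' j) * (X' i * D' j) = if i = j then X' i * D' j else 0 := by
        have : (X' i * D' j) * (X' i * D' j) = X' i * (D' j * X' i) * D' j := by
          simp only [mul_assoc]
        rw [this, hDX, mul_add, mul_neg, ← mul_assoc, hXX, zero_mul, neg_zero, zero_add]
        by_cases e : i = j
        · rw [if_pos e, if_pos e.symm, mul_one]
        · rw [if_neg e, if_neg (Ne.symm e), mul_zero, zero_mul]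
      by_cases e : i = j
      · rw [if_pos e] at hsq ⊢
        exact IsIdempotentElem.pow_eq hsq hp.out.ne_zero
      · rw [if_neg e] at hsq ⊢
        obtain ⟨k, rfl⟩ := Nat.exists_eq_add_of_lt hp2
        rw [add_assoc, pow_add, pow_two, hsq, zero_mul]
  · intro i j hij
    have hne : j ≠ i := by rintro rfl; exact irrefl_of r j hij
    -- The vacuum is killed by $X_i$ for $i\in P$ and by $D_j$ for $j\notin P$. As `P` is an initial
    -- segment, one of the two applies whenever $i\prec j$.
    by_cases h : P j
    · have := hWf.DX j i
      rw [if_neg hne, add_zero] at this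
      have h1 : X' i * D' j = sgn F (q j) (q i) • (D' j * X' i) := by
        rw [this, smul_smul, sgn_mul_self, one_smul]
      change (X' i * D' j) v = 0
      rw [h1, LinearMap.smul_apply, Module.End.mul_apply, hXv (hP i j hij h), map_zero, smul_zero]
    · change X' i (D' j v) = 0
      rw [hDv' h, map_zero]
  · intro i
    change _ = (if P i then -sgn F (q i) (q i) else 0) • v
    by_cases h : P i
    -- Inside `P` the vacuum is killed by $X_i$, so the relation $D_iX_i=\pm X_iD_i+1$ determines
    -- the eigenvalue of $X_iD_i$.
    · have h1 := hWf.DX i i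
      rw [if_pos rfl] at h1
      have h2 := LinearMap.congr_fun h1 v
      rw [Module.End.mul_apply, hXv h, map_zero, LinearMap.add_apply, LinearMap.smul_apply,
        Module.End.one_apply] at h2
      have h3 : sgn F (q i) (q i) • (X' i * D' i) v = -v := eq_neg_of_add_eq_zero_left h2.symm
      have h4 := congrArg (fun x => sgn F (q i) (q i) • x) h3
      simp only [smul_smul, sgn_mul_self, one_smul] at h4
      change (X' i * D' i) v = _
      rw [h4, if_pos h, smul_neg, neg_smul]
    · change X' i (D' i v) = _
      rw [hDv' h, map_zero, if_neg h, zero_smul]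

end Modules
end SuperGL
end

noncomputable section
namespace SuperGL

/-! ### Modules for every weight and every $p$-character in standard Levi form -/

section Existence
universe u
variable {F : Type u} [Field F] {p m n : ℕ} [hp : Fact p.Prime] [CharP F p]
  {r : Fin m ⊕ Fin n → Fin m ⊕ Fin n → Prop} [IsStrictTotalOrder (Fin m ⊕ Fin n) r]

open Classical in
/-- The weights of highest weight vectors with `p`-character zero form a group. -/
def highestWeights (hp2 : 2 < p) (F : Type u) [Field F] [CharP F p]
    (r : Fin m ⊕ Fin n → Fin m ⊕ Fin n → Prop) [IsStrictTotalOrder (Fin m ⊕ Fin n) r] :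
    AddSubgroup (Fin m ⊕ Fin n → F) :=
  let S : AddSubmonoid (Fin m ⊕ Fin n → F) :=
    { carrier := {w | HasHighestWeight p r 0 w}
      add_mem' := fun {a b} ha hb => by
        have := HasHighestWeight.add ha hb
        rwa [add_zero] at this
      zero_mem' := by
        have := hasHighestWeight_fock (F := F) (r := r) hp2 (fun _ => False)
          (fun _ _ _ h => h) 0 0 0 (fun i j _ => by simp [hp.out.ne_zero])
        simp only [if_false] at this
        exact this }
  { S with
    neg_mem' := fun {w} hw => by
      -- In characteristic `p`, negatives are natural multiples, so closure under tensor products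
      -- suffices.
      have h1 : (p - 1) • w ∈ S := S.nsmul_mem hw _
      have h2 : -w = (p - 1) • w := by
        rw [neg_eq_iff_add_eq_zero]
        nth_rewrite 1 [← one_nsmul w]
        rw [← add_nsmul, Nat.add_sub_cancel' hp.out.one_le]
        funext i
        simp
      rw [h2]; exact h1 }

theorem mem_highestWeights {hp2 : 2 < p} {w : Fin m ⊕ Fin n → F} :
    w ∈ highestWeights hp2 F r ↔ HasHighestWeight p r 0 w := Iff.rfl

open Classical in
theorem single_mem_highestWeights (hp2 : 2 < p) (i : Fin m ⊕ Fin n) :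
    Pi.single i 1 ∈ highestWeights hp2 F r := by
  -- The segments below `i`, with and without `i` itself, give weights that differ only at `i`. The
  -- shift `parity i + 1` makes that variable odd, so the difference is $-(-1)=1$.
  have h1 := hasHighestWeight_fock (F := F) (r := r) hp2 (fun j => r j i ∨ j = i)
    (fun a b hab h => Or.inl (h.elim (fun h => trans_of r hab h) (fun h => h ▸ hab)))
    (parity i + 1) 0 0 (fun i j _ => by simp [hp.out.ne_zero])
  have h2 := hasHighestWeight_fock (F := F) (r := r) hp2 (fun j => r j i)
    (fun a b hab h => trans_of r hab h)
    (parity i + 1) 0 0 (fun i j _ => by simp [hp.out.ne_zero])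
  rw [← mem_highestWeights (hp2 := hp2)] at h1 h2
  convert sub_mem h1 h2 using 1
  funext j
  by_cases hj : j = i
  · subst hj
    have h3 : (parity j + (parity j + 1) : ZMod 2) = 1 := by
      have : ∀ x : ZMod 2, x + (x + 1) = 1 := by decide
      exact this _
    simp [irrefl_of r j, h3]
  · simp [hj]

theorem hasHighestWeight_zero (hp2 : 2 < p) {w : Fin m ⊕ Fin n → F} (hw : ∀ i, w i ^ p = w i) :
    HasHighestWeight p r 0 w := by
  -- The fixed points of Frobenius form the prime field.
  have h1 : ∀ i, ∃ k : ℕ, w i = (k : F) := by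
    intro i
    have h := (ZMod.fieldRange_castHom_eq_bot (K := F) p).ge
      ((Subfield.mem_bot_iff_pow_eq_self (F := F) (p := p)).2 (hw i))
    obtain ⟨k, hk⟩ := h
    exact ⟨k.val, by rw [← hk]; simp⟩
  choose k hk using h1
  rw [← mem_highestWeights (hp2 := hp2)]
  have h2 : w = ∑ i, k i • Pi.single i (1 : F) := by
    funext j
    rw [Finset.sum_apply, Finset.sum_eq_single j]
    · simp [hk]
    · intro i _ hij
      simp [Pi.single_eq_of_ne (Ne.symm hij)]
    · simp
  rw [h2]
  exact sum_mem fun i _ => nsmul_mem (single_mem_highestWeights hp2 i) _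

open Classical in
theorem hasHighestWeight_single (hp2 : 2 < p) {a b : Fin m ⊕ Fin n} (hab : r a b)
    (hpar : (parity b : ZMod 2) = parity a) (x : F) :
    HasHighestWeight p r (fun i j => if i = b ∧ j = a then x else 0) 0 := by
  have hne : a ≠ b := by rintro rfl; exact irrefl_of r _ hab
  have h2 : ∀ x : ZMod 2, x + x = 0 := by decide
  have hP : ∀ i j, r i j → (r j a ∨ j = a) → (r i a ∨ i = a) :=
    fun i j hij h => Or.inl (h.elim (fun h => trans_of r hij h) (fun h => h ▸ hij))
  -- With `P` ending at `a`, and `a`, `b` the only indices with nonzero parameter, $e_{ba}$ alone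
  -- has a nonzero $p$-character. Its $p$-th power is $t_bt_a=x^p$, which explains the choice of
  -- `t`.
  have h1 := hasHighestWeight_fock (F := F) (r := r) hp2 (fun j => r j a ∨ j = a) hP
    (parity a) (fun i => if i = a then x ^ p else if i = b then 1 else 0)
    (fun i j => if i = b ∧ j = a then x else 0) (by
      intro i j _
      have hb : ¬ (r b a ∨ b = a) := by
        rintro (h | h)
        · exact asymm_of r hab h
        · exact hne h.symm
      by_cases hi : i = b
      · subst hi
        by_cases hj : j = a
        · subst hj
          simp [Ne.symm hne, asymm_of r hab, hpar, h2]
        · rw [if_neg (fun h => hj h.2), zero_pow hp.out.ne_zero]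
          by_cases h3 : r j a ∨ j = a
          · have hji : j ≠ i := by rintro rfl; exact hb h3
            simp [hj, hji]
          · simp [h3]
      · rw [if_neg (fun h => hi h.1), zero_pow hp.out.ne_zero]
        split_ifs with h3
        all_goals simp_all)
  -- The same segment with all parameters zero has the same weight and $p$-character zero; tensoring
  -- with the opposite weight removes the weight.
  have h3 := hasHighestWeight_fock (F := F) (r := r) hp2 (fun j => r j a ∨ j = a) hP
    (parity a) 0 0 (fun i j _ => by simp [hp.out.ne_zero])
  rw [← mem_highestWeights (hp2 := hp2)] at h3
  have h4 := h1.add (neg_mem h3)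
  rwa [add_zero, add_neg_cancel] at h4

-- Tensor together one module for each matrix unit on which `c` is nonzero, and one module of
-- $p$-character zero carrying the weight. Simplicity of the roots plays no role here.
open Classical in
theorem hasHighestWeight_of_pow_eq (hp2 : 2 < p) {c : Fin m ⊕ Fin n → Fin m ⊕ Fin n → F}
    (hc : ∀ i j, c i j ≠ 0 → r j i ∧ (parity i : ZMod 2) = parity j)
    {w : Fin m ⊕ Fin n → F} (hw : ∀ i, w i ^ p = w i) : HasHighestWeight p r c w := by
  have h : ∀ S : Finset ((Fin m ⊕ Fin n) × (Fin m ⊕ Fin n)),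
      HasHighestWeight p r (fun i j => if (i, j) ∈ S then c i j else 0) 0 := by
    intro S
    induction S using Finset.induction_on with
    | empty =>
      have := hasHighestWeight_zero (F := F) (r := r) hp2 (w := 0) (fun i => by simp [hp.out.ne_zero])
      convert this using 1
      funext i j
      simp
    | insert a S ha ih =>
      by_cases h0 : c a.1 a.2 = 0
      · convert ih using 3 with i j
        by_cases e : (i, j) = a
        · subst e; simp [h0]
        · simp [e]
      · obtain ⟨h1, h2⟩ := hc _ _ h0
        convert ih.add (hasHighestWeight_single hp2 h1 h2 (c a.1 a.2)) using 1
        · funext i j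
          rw [Pi.add_apply, Pi.add_apply]
          by_cases e : (i, j) = a
          · subst e; simp [ha]
          · have : ¬ (i = a.1 ∧ j = a.2) := fun h => e (Prod.ext h.1 h.2)
            simp [e, this]
        · simp
  have h1 := (h Finset.univ).add (hasHighestWeight_zero hp2 hw)
  simpa using h1

end Existence
end SuperGL
end

noncomputable section
namespace SuperGL

/-! ### From matrix units to all of $gl(m|n)$ -/

section Extend
variable {F : Type*} [Field F] {p m n : ℕ}

theorem single_mem_deg {i : ZMod 2} {a b : Fin m ⊕ Fin n} (h : parity a + parity b = i) :
    Matrix.single a b (1 : F) ∈ deg F m n i := by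
  intro a' b' hab
  rw [Matrix.single_apply, if_neg]
  rintro ⟨rfl, rfl⟩
  exact hab h

theorem deg_le_of_single_mem {i : ZMod 2} (S : Submodule F (gl F m n))
    (h : ∀ a b : Fin m ⊕ Fin n, parity a + parity b = i → Matrix.single a b (1 : F) ∈ S) :
    deg F m n i ≤ S := by
  intro x hx
  rw [Matrix.matrix_eq_sum_single x]
  refine S.sum_mem fun a _ => S.sum_mem fun b _ => ?_
  by_cases hab : parity a + parity b = i
  · have : Matrix.single a b (x a b) = x a b • Matrix.single a b (1 : F) := by
      rw [Matrix.smul_single, smul_eq_mul, mul_one]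
    rw [this]
    exact S.smul_mem _ (h a b hab)
  · rw [hx a b hab, Matrix.single_zero]
    exact S.zero_mem

variable {M : Type*} [AddCommGroup M] [Module F M]

/-- The linear map on `gl(m|n)` that sends the matrix units to given operators. -/
def ofUnits (e : Fin m ⊕ Fin n → Fin m ⊕ Fin n → Module.End F M) :
    gl F m n →ₗ[F] Module.End F M where
  toFun A := ∑ i, ∑ j, A i j • e i j
  map_add' A B := by
    simp only [Matrix.add_apply, add_smul, Finset.sum_add_distrib]
  map_smul' c A := by
    simp only [Matrix.smul_apply, smul_eq_mul, mul_smul, Finset.smul_sum, RingHom.id_apply]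

theorem ofUnits_apply (e : Fin m ⊕ Fin n → Fin m ⊕ Fin n → Module.End F M) (A : gl F m n) :
    ofUnits e A = ∑ i, ∑ j, A i j • e i j := rfl

@[simp] theorem ofUnits_single (e : Fin m ⊕ Fin n → Fin m ⊕ Fin n → Module.End F M)
    (a b : Fin m ⊕ Fin n) : ofUnits e (Matrix.single a b 1) = e a b := by
  rw [ofUnits_apply, Finset.sum_eq_single a, Finset.sum_eq_single b]
  · simp
  · intro j _ hj
    simp [Ne.symm hj]
  · simp
  · intro i _ hi
    refine Finset.sum_eq_zero fun j _ => ?_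
    simp [Ne.symm hi]
  · simp

theorem single_mul_single_eq (a b c d : Fin m ⊕ Fin n) :
    (Matrix.single a b 1 * Matrix.single c d 1 : gl F m n)
      = if b = c then Matrix.single a d 1 else 0 := by
  split_ifs with h
  · subst h; simp
  · simp [h]

theorem single_pow_eq {p : ℕ} (hp : 2 ≤ p) (a b : Fin m ⊕ Fin n) :
    (Matrix.single a b 1 : gl F m n) ^ p = if a = b then Matrix.single a b 1 else 0 := by
  split_ifs with h
  · subst h
    exact IsIdempotentElem.pow_eq (by rw [IsIdempotentElem, single_mul_single_eq, if_pos rfl])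
      (by omega)
  · obtain ⟨k, rfl⟩ := Nat.exists_eq_add_of_le hp
    rw [pow_add, pow_two, single_mul_single_eq, if_neg (Ne.symm h), zero_mul]

theorem IsReducedAction.ofUnits_bracket {c : Fin m ⊕ Fin n → Fin m ⊕ Fin n → F}
    {e : Fin m ⊕ Fin n → Fin m ⊕ Fin n → Module.End F M} {γ : Module.End F M}
    (h : IsReducedAction p c e γ) {i j : ZMod 2} {x y : gl F m n}
    (hx : x ∈ deg F m n i) (hy : y ∈ deg F m n j) :
    ofUnits e x * ofUnits e y - sgn F i j • (ofUnits e y * ofUnits e x)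
      = ofUnits e (superBracket i j x y) := by
  -- `L` and `R` are the same bilinear defect, read as linear in the first and in the second
  -- argument; it is checked on matrix units.
  let L : gl F m n → gl F m n →ₗ[F] Module.End F M := fun y =>
    LinearMap.mulRight F (ofUnits e y) ∘ₗ ofUnits e
      - sgn F i j • (LinearMap.mulLeft F (ofUnits e y) ∘ₗ ofUnits e)
      - ofUnits e ∘ₗ (LinearMap.mulRight F y - sgn F i j • LinearMap.mulLeft F y)
  let R : gl F m n → gl F m n →ₗ[F] Module.End F M := fun x =>
    LinearMap.mulLeft F (ofUnits e x) ∘ₗ ofUnits e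
      - sgn F i j • (LinearMap.mulRight F (ofUnits e x) ∘ₗ ofUnits e)
      - ofUnits e ∘ₗ (LinearMap.mulLeft F x - sgn F i j • LinearMap.mulRight F x)
  have hLR : ∀ x y, L y x = R x y := fun x y => rfl
  have key : L y x = 0 := by
    refine deg_le_of_single_mem (LinearMap.ker (L y)) (fun a b hab => ?_) hx
    rw [LinearMap.mem_ker, hLR]
    refine deg_le_of_single_mem (LinearMap.ker (R _)) (fun c d hcd => ?_) hy
    rw [LinearMap.mem_ker]
    have hb := h.bracket a b c d
    rw [hab, hcd] at hb
    simp only [R, LinearMap.sub_apply, LinearMap.smul_apply, LinearMap.comp_apply,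
      LinearMap.mulLeft_apply, LinearMap.mulRight_apply, ofUnits_single, single_mul_single_eq]
    rw [hb, map_sub, map_smul]
    split_ifs <;> simp
  exact sub_eq_zero.1 key

theorem superBracket_zero (x y : gl F m n) : superBracket 0 0 x y = x * y - y * x := by
  simp [superBracket]

theorem mul_mem_deg_zero {x y : gl F m n} (hx : x ∈ deg F m n 0) (hy : y ∈ deg F m n 0) :
    x * y ∈ deg F m n 0 := by
  intro a b hab
  rw [Matrix.mul_apply]
  refine Finset.sum_eq_zero fun k _ => ?_
  by_cases h1 : (parity a + parity k : ZMod 2) = 0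
  · by_cases h2 : (parity k + parity b : ZMod 2) = 0
    · exfalso
      have : ∀ x y z : ZMod 2, x + y = 0 → y + z = 0 → x + z = 0 := by decide
      exact hab (this _ _ _ h1 h2)
    · rw [hy _ _ h2, mul_zero]
  · rw [hx _ _ h1, zero_mul]

theorem IsReducedAction.ofUnits_pow [hp : Fact p.Prime] [CharP F p] [Nontrivial M]
    {χ : PChar F m n}
    {e : Fin m ⊕ Fin n → Fin m ⊕ Fin n → Module.End F M} {γ : Module.End F M}
    (h : IsReducedAction p (fun i j => PChar.ext χ (Matrix.single i j 1)) e γ)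
    {x : gl F m n} (hx : x ∈ deg F m n 0) :
    ofUnits e x ^ p - ofUnits e (x ^ p) = algebraMap F _ (PChar.ext χ x ^ p) := by
  have : CharP (Module.End F M) p := charP_end F p M
  have : CharP (Module.End F M × gl F m n) p :=
    charP_of_injective_algebraMap (algebraMap F (Module.End F M × gl F m n)).injective p
  -- `Γ` is the graph of the action on the even part. Jacobson's formula in the product algebra
  -- shows that the correction term of the operators is the image of the correction term of the
  -- matrices, so the relation is additive.
  let Γ : Submodule F (Module.End F M × gl F m n) :=
    (deg F m n 0).map ((ofUnits e).prod LinearMap.id)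
  have hΓ : ∀ x ∈ Γ, ∀ y ∈ Γ, x * y - y * x ∈ Γ := by
    rintro _ ⟨x, hx, rfl⟩ _ ⟨y, hy, rfl⟩
    refine ⟨x * y - y * x, Submodule.sub_mem _ (mul_mem_deg_zero hx hy) (mul_mem_deg_zero hy hx), ?_⟩
    have := h.ofUnits_bracket hx hy
    rw [superBracket_zero, sgn_zero_left, one_smul] at this
    refine Prod.ext ?_ rfl
    exact this.symm
  let S : Submodule F (gl F m n) :=
    { carrier := {x | x ∈ deg F m n 0 ∧
        ofUnits e x ^ p - ofUnits e (x ^ p) = algebraMap F _ (PChar.ext χ x ^ p)}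
      zero_mem' := ⟨Submodule.zero_mem _, by simp [hp.out.ne_zero]⟩
      add_mem' := by
        rintro x y ⟨hx, hx'⟩ ⟨hy, hy'⟩
        refine ⟨Submodule.add_mem _ hx hy, ?_⟩
        obtain ⟨z, hz, hz'⟩ := add_pow_sub_pow_sub_pow_mem p Γ hΓ
          (Submodule.mem_map_of_mem (f := (ofUnits e).prod LinearMap.id) hx)
          (Submodule.mem_map_of_mem (f := (ofUnits e).prod LinearMap.id) hy)
        have h1 : ofUnits e z = (ofUnits e x + ofUnits e y) ^ p - ofUnits e x ^ p - ofUnits e y ^ p :=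
          congrArg Prod.fst hz'
        have h2 : z = (x + y) ^ p - x ^ p - y ^ p := congrArg Prod.snd hz'
        rw [h2, map_sub, map_sub] at h1
        rw [map_add, map_add, add_pow_char, map_add, ← hx', ← hy']
        rw [← sub_eq_zero] at h1 ⊢
        rw [← neg_eq_zero, ← h1]
        abel
      smul_mem' := by
        rintro c x ⟨hx, hx'⟩
        refine ⟨Submodule.smul_mem _ c hx, ?_⟩
        rw [map_smul, map_smul, smul_pow, smul_pow, map_smul, ← smul_sub, hx', smul_eq_mul, mul_pow,
          map_mul, Algebra.smul_def] }
  refine (deg_le_of_single_mem S (fun a b hab => ⟨single_mem_deg hab, ?_⟩) hx).2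
  have hpar : (parity a : ZMod 2) = parity b := by
    have : ∀ x y : ZMod 2, x + y = 0 → x = y := by decide
    exact this _ _ hab
  rw [ofUnits_single, h.pow a b hpar, single_pow_eq hp.out.two_le, Algebra.algebraMap_eq_smul_one]
  split_ifs <;> simp

end Extend

/-! ### Nonvanishing of the generator -/

section Generator
universe u
variable {F : Type u} [Field F] {m n p : ℕ}

theorem ReducedEnv.lift_ι (𝔞 : RestrictedSub F m n p) (χ : PChar F m n)
    {A : Type*} [Ring A] [Algebra F A] (φ : 𝔞.carrier →ₗ[F] A) (hb) (hp) (x : 𝔞.carrier) :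
    ReducedEnv.lift 𝔞 χ φ hb hp (ReducedEnv.ι 𝔞 χ x) = φ x := by
  simp only [ReducedEnv.lift, ReducedEnv.ι, LinearMap.comp_apply, AlgHom.toLinearMap_apply]
  rw [RingQuot.liftAlgHom_mkAlgHom_apply, TensorAlgebra.lift_ι_apply]

theorem ReducedEnv.induction {𝔞 : RestrictedSub F m n p} {χ : PChar F m n}
    (S : Subalgebra F (ReducedEnv 𝔞 χ)) (h : ∀ x, ReducedEnv.ι 𝔞 χ x ∈ S) (u : ReducedEnv 𝔞 χ) :
    u ∈ S := by
  obtain ⟨t, rfl⟩ := RingQuot.mkAlgHom_surjective F (ReducedRel 𝔞 χ) u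
  induction t using TensorAlgebra.induction with
  | algebraMap c => rw [AlgHom.commutes]; exact S.algebraMap_mem c
  | ι x => exact h x
  | mul a b ha hb => rw [map_mul]; exact S.mul_mem ha hb
  | add a b ha hb => rw [map_add]; exact S.add_mem ha hb

theorem single_self_mem_cartan (i : Fin m ⊕ Fin n) : Matrix.single i i (1 : F) ∈ cartan F m n := by
  intro a b hab
  rw [Matrix.single_apply, if_neg]
  rintro ⟨rfl, rfl⟩
  exact hab rfl

variable {r : Fin m ⊕ Fin n → Fin m ⊕ Fin n → Prop}

/-- Universal property: a highest weight vector of the right weight in any module receives a map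
from the baby Verma module that sends the generator to it. -/
theorem gen_ne_zero [hp : Fact p.Prime] [CharP F p] [IsStrictTotalOrder (Fin m ⊕ Fin n) r]
    {χ : PChar F m n}
    (hχ : VanishesOnNilPos r χ) {l : Module.Dual F (cartan F m n)} (hl : IsWeight p χ l)
    (h : HasHighestWeight p r (fun i j => PChar.ext χ (Matrix.single i j 1))
      (fun i => l ⟨Matrix.single i i 1, single_self_mem_cartan i⟩)) :
    BabyVerma.gen hχ hl ≠ 0 := by
  obtain ⟨M, _, _, e, γ, v, he, hv, hpos, hw⟩ := h
  have : Nontrivial M := ⟨v, 0, hv⟩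
  let ψ : ReducedEnv (whole F m n p) χ →ₐ[F] Module.End F M :=
    ReducedEnv.lift (whole F m n p) χ (ofUnits e ∘ₗ (whole F m n p).carrier.subtype)
      (fun i j x y hx hy => he.ofUnits_bracket hx hy)
      (fun x hx => by
        have := he.ofUnits_pow hx
        rw [PChar.ext_of_mem χ hx] at this
        exact this)
  have hψι : ∀ x, ψ (ReducedEnv.ι (whole F m n p) χ x) = ofUnits e (x : gl F m n) :=
    fun x => ReducedEnv.lift_ι _ _ _ _ _ x
  have hborel : ∀ b : ReducedEnv (borel F m n r p) χ,
      ψ (ReducedEnv.incl (𝔞 := borel F m n r p) (𝔟 := whole F m n p) le_top χ b) v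
        = weightChar hχ hl b • v := by
    let S : Subalgebra F (ReducedEnv (borel F m n r p) χ) :=
      { carrier := {b | ψ (ReducedEnv.incl (𝔞 := borel F m n r p) (𝔟 := whole F m n p) le_top χ b) v
          = weightChar hχ hl b • v}
        mul_mem' := fun {a b} ha hb => by
          rw [Set.mem_ofPred_eq] at *
          rw [map_mul, map_mul, Module.End.mul_apply, hb, map_smul, ha, map_mul, smul_smul, mul_comm]
        add_mem' := fun {a b} ha hb => by
          rw [Set.mem_ofPred_eq] at *
          rw [map_add, map_add, LinearMap.add_apply, ha, hb, map_add, add_smul]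
        algebraMap_mem' := fun c => by
          rw [Set.mem_ofPred_eq, AlgHom.commutes, AlgHom.commutes, AlgHom.commutes]
          rfl }
    refine fun b => ReducedEnv.induction S (fun x => ?_) b
    change ψ (ReducedEnv.incl _ χ (ReducedEnv.ι _ χ x)) v = weightChar hχ hl (ReducedEnv.ι _ χ x) • v
    have h1 : ReducedEnv.incl (𝔞 := borel F m n r p) (𝔟 := whole F m n p) le_top χ
        (ReducedEnv.ι _ χ x) = ReducedEnv.ι (whole F m n p) χ ⟨x, Submodule.mem_top⟩ := ReducedEnv.lift_ι _ _ _ _ _ x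
    have h2 : weightChar hχ hl (ReducedEnv.ι _ χ x) = l (toCartan F m n (x : gl F m n)) :=
      ReducedEnv.lift_ι _ _ _ _ _ x
    rw [h1, h2, hψι, ofUnits_apply]
    have h3 : toCartan F m n (x : gl F m n) = ∑ i, (x : gl F m n) i i •
        (⟨Matrix.single i i 1, single_self_mem_cartan i⟩ : cartan F m n) := by
      apply Subtype.ext
      rw [Submodule.coe_sum]
      ext a b
      rw [Matrix.sum_apply]
      change Matrix.diagonal _ a b = ∑ i, ((x : gl F m n) i i • Matrix.single i i (1 : F)) a b
      rw [Finset.sum_eq_single a]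
      · by_cases hab : a = b
        · subst hab; simp
        · simp [hab]
      · intro i _ hi
        simp [hi]
      · simp
    rw [h3, map_sum, Finset.sum_smul, LinearMap.sum_apply]
    refine Finset.sum_congr rfl fun i _ => ?_
    rw [LinearMap.sum_apply, Finset.sum_eq_single i]
    · rw [LinearMap.smul_apply, hw, map_smul, smul_eq_mul, mul_smul]
    · intro j _ hji
      rw [LinearMap.smul_apply]
      rcases trichotomous_of r i j with h4 | h4 | h4
      · rw [hpos i j h4, smul_zero]
      · exact absurd h4.symm hji
      · rw [mem_borel_iff.1 x.2 i j h4, zero_smul]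
    · simp
  let Φ : ReducedEnv (whole F m n p) χ ⊗[F] F →ₗ[F] M :=
    TensorProduct.lift (LinearMap.mk₂ F (fun u c => c • ψ u v)
      (by intro u u' c; simp) (by intro a u c; rw [map_smul, LinearMap.smul_apply, smul_comm]) (by intro u c c'; simp [add_smul])
      (by intro a u c; simp [mul_smul]))
  have hΦ : ∀ u c, Φ (u ⊗ₜ c) = c • ψ u v := fun u c => rfl
  have hΦs : ∀ (a : ReducedEnv (whole F m n p) χ) t, Φ (a • t) = ψ a (Φ t) := by
    intro a t
    induction t using TensorProduct.induction_on with
    | zero => simp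
    | tmul u c => rw [TensorProduct.smul_tmul', hΦ, hΦ, smul_eq_mul, map_mul, Module.End.mul_apply, map_smul]
    | add x y hx hy => rw [smul_add, map_add, hx, hy, map_add, map_add]
  intro h0
  rw [BabyVerma.gen, Submodule.Quotient.mk_eq_zero] at h0
  have hker : ∀ t ∈ Submodule.span (ReducedEnv (whole F m n p) χ)
      {t : ReducedEnv (whole F m n p) χ ⊗[F] F | ∃ (a : ReducedEnv (whole F m n p) χ)
        (b : ReducedEnv (borel F m n r p) χ) (x : F),
        t = (a * ReducedEnv.incl (𝔞 := borel F m n r p) (𝔟 := whole F m n p) le_top χ b) ⊗ₜ[F] x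
          - a ⊗ₜ[F] ((Algebra.lmul F F).comp (weightChar hχ hl) b x)}, Φ t = 0 := by
    intro t ht
    induction ht using Submodule.span_induction with
    | mem t ht =>
      obtain ⟨a, b, x, rfl⟩ := ht
      rw [map_sub, hΦ, hΦ, map_mul, Module.End.mul_apply, hborel, map_smul, smul_smul, sub_eq_zero]
      congr 1
      simp [mul_comm]
    | zero => exact map_zero _
    | add x y _ _ hx hy => rw [map_add, hx, hy, add_zero]
    | smul a x _ hx => rw [hΦs, hx, map_zero]
  have := hker _ h0
  rw [hΦ, one_smul, map_one] at this
  exact hv this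

end Generator
end SuperGL
end

noncomputable section
namespace SuperGL

/-! ### Nilpotent spaces of operators and cyclic modules over them -/

section Nilpotent
variable {F : Type*} [Field F] {U : Type*} [Ring U] [Algebra F U]

/-- Letters can be moved past `G` one at a time, so the condition need only be checked on
generators. -/
theorem adjoin_mul_le {s : Set U} {G : Submodule F U}
    (h : ∀ x ∈ s, ∀ g ∈ G, x * g ∈ G * (Algebra.adjoin F s).toSubmodule) :
    (Algebra.adjoin F s).toSubmodule * G ≤ G * (Algebra.adjoin F s).toSubmodule := by
  set B := Algebra.adjoin F s with hB
  have hGB : ∀ z ∈ G * B.toSubmodule, ∀ b ∈ B, z * b ∈ G * B.toSubmodule := by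
    intro z hz b hb
    induction hz using Submodule.mul_induction_on' with
    | mem_mul_mem g hg b' hb' =>
      rw [mul_assoc]
      exact Submodule.mul_mem_mul hg (B.mul_mem hb' hb)
    | add x _ y _ hx hy => rw [add_mul]; exact Submodule.add_mem _ hx hy
  rw [Submodule.mul_le]
  intro u hu
  rw [Subalgebra.mem_toSubmodule] at hu
  induction hu using Algebra.adjoin_induction with
  | mem x hx => exact h x hx
  | algebraMap c =>
    intro g hg
    rw [Algebra.commutes]
    exact Submodule.mul_mem_mul hg (B.algebraMap_mem c)
  | add x y _ _ hx hy =>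
    intro g hg
    rw [add_mul]
    exact Submodule.add_mem _ (hx g hg) (hy g hg)
  | mul x y hx' _ hx hy =>
    intro g hg
    rw [mul_assoc]
    have : ∀ z ∈ G * B.toSubmodule, x * z ∈ G * B.toSubmodule := by
      intro z hz
      induction hz using Submodule.mul_induction_on' with
      | mem_mul_mem g hg b hb =>
        rw [← mul_assoc]
        exact hGB _ (hx g hg) b hb
      | add x _ y _ hx hy => rw [mul_add]; exact Submodule.add_mem _ hx hy
    exact this _ (hy g hg)

theorem mul_subalgebra_pow_le {G : Submodule F U} {B : Subalgebra F U}
    (h : B.toSubmodule * G ≤ G * B.toSubmodule) (k : ℕ) :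
    (G * B.toSubmodule) ^ k ≤ G ^ k * B.toSubmodule := by
  induction k with
  | zero =>
    rw [pow_zero, pow_zero, one_mul, Submodule.one_le]
    exact B.one_mem
  | succ k ih =>
    calc (G * B.toSubmodule) ^ (k + 1) = (G * B.toSubmodule) ^ k * (G * B.toSubmodule) := pow_succ _ _
      _ ≤ G ^ k * B.toSubmodule * (G * B.toSubmodule) := mul_le_mul' ih le_rfl
      _ = G ^ k * (B.toSubmodule * G) * B.toSubmodule := by simp only [mul_assoc]
      _ ≤ G ^ k * (G * B.toSubmodule) * B.toSubmodule :=
        mul_le_mul' (mul_le_mul' le_rfl h) le_rfl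
      _ = G ^ (k + 1) * (B.toSubmodule * B.toSubmodule) := by rw [pow_succ]; simp only [mul_assoc]
      _ = G ^ (k + 1) * B.toSubmodule := by rw [B.isIdempotentElem_toSubmodule.eq]

/-- Adding a nilpotent element that normalizes a space generating a nilpotent algebra. -/
theorem sup_span_singleton_pow_eq_bot {G : Submodule F U} {y : U} {k p : ℕ} (hG : G ^ k = ⊥)
    (hy : y ^ p = 0) (hyG : ∀ g ∈ G, ∃ g₁ ∈ G, ∃ g₂ ∈ G, y * g = g₁ * y + g₂) :
    (G ⊔ Submodule.span F {y}) ^ (p * k) = ⊥ := by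
  set B := Algebra.adjoin F ((G : Set U) ∪ {y}) with hB
  have hGB : G ≤ B.toSubmodule := fun x hx => Algebra.subset_adjoin (Or.inl hx)
  have hyB : y ∈ B := Algebra.subset_adjoin (Or.inr rfl)
  have hYB : Submodule.span F {y} ≤ B.toSubmodule := by
    rw [Submodule.span_singleton_le_iff_mem]; exact hyB
  have hBG : B.toSubmodule * G ≤ G * B.toSubmodule := by
    refine adjoin_mul_le fun x hx g hg => ?_
    rcases hx with hx | hx
    · exact Submodule.mul_mem_mul hx (hGB hg)
    · obtain ⟨g₁, h₁, g₂, h₂, e⟩ := hyG g hg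
      rw [Set.mem_singleton_iff.1 hx, e]
      refine Submodule.add_mem _ (Submodule.mul_mem_mul h₁ hyB) ?_
      rw [← mul_one g₂]
      exact Submodule.mul_mem_mul h₂ B.one_mem
  have hBB : B.toSubmodule * B.toSubmodule ≤ B.toSubmodule := (B.isIdempotentElem_toSubmodule.eq).le
  have hYj : ∀ j, Submodule.span F {y} ^ j ≤ B.toSubmodule := by
    intro j
    rw [Submodule.span_pow, Set.singleton_pow, Submodule.span_singleton_le_iff_mem]
    exact B.pow_mem hyB j
  -- A word with a letter from `G` can be rewritten with such a letter in front; the only other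
  -- words are powers of `y`. For `j = p` these vanish, which leaves $(GB)^k\subseteq G^kB=0$.
  have hj : ∀ j, (G ⊔ Submodule.span F {y}) ^ j ≤ G * B.toSubmodule ⊔ Submodule.span F {y} ^ j := by
    intro j
    induction j with
    | zero => rw [pow_zero, pow_zero]; exact le_sup_right
    | succ j ih =>
      rw [pow_succ']
      refine (mul_le_mul' le_rfl ih).trans ?_
      rw [Submodule.sup_mul, Submodule.mul_sup (Submodule.span F {y}), ← pow_succ']
      refine sup_le (le_sup_of_le_left ?_) (sup_le (le_sup_of_le_left ?_) le_sup_right)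
      · refine mul_le_mul' le_rfl (sup_le ?_ (hYj j))
        exact (mul_le_mul' hGB le_rfl).trans hBB
      · rw [← mul_assoc]
        refine (mul_le_mul' ((mul_le_mul' hYB le_rfl).trans hBG) le_rfl).trans ?_
        rw [mul_assoc]
        exact mul_le_mul' le_rfl hBB
  have hp : (G ⊔ Submodule.span F {y}) ^ p ≤ G * B.toSubmodule := by
    refine (hj p).trans (sup_le le_rfl ?_)
    rw [Submodule.span_pow, Set.singleton_pow, hy]
    simp
  rw [pow_mul, eq_bot_iff]
  refine (pow_le_pow_left' hp k).trans ((mul_subalgebra_pow_le hBG k).trans ?_)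
  rw [hG, Submodule.bot_mul]

variable {σ : Type*} [Fintype σ] [DecidableEq σ] {r : σ → σ → Prop} [IsStrictTotalOrder σ r]

/-- Nilpotent elements `y i j`, for `j` smaller than `i`, with the commutation relations of strictly
triangular matrix units up to coefficients, generate a nilpotent algebra. -/
theorem exists_span_pow_eq_bot (y : σ → σ → U) {p : ℕ}
    (hy : ∀ i j, r j i → y i j ^ p = 0)
    (hbr : ∀ i j k l, r j i → r l k → ∃ a : F, y i j * y k l - a • (y k l * y i j)
      = (if j = k then y i l else 0) - a • (if l = i then y k j else 0)) :
    ∃ N, Submodule.span F {x | ∃ i j, r j i ∧ x = y i j} ^ N = ⊥ := by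
  classical
  -- Induction over sets of negative roots closed under enlarging the interval from `j` to `i`.
  -- Brackets of negative root vectors only enlarge intervals.
  have main : ∀ R : Finset (σ × σ), (∀ α ∈ R, r α.2 α.1) →
      (∀ i j l, (i, j) ∈ R → r l j → (i, l) ∈ R) → (∀ i j k, (i, j) ∈ R → r i k → (k, j) ∈ R) →
      ∃ N, Submodule.span F ((fun α : σ × σ => y α.1 α.2) '' R) ^ N = ⊥ := by
    intro R
    induction R using Finset.strongInduction with
    | H R ih =>
    intro hneg h1 h2
    rcases R.eq_empty_or_nonempty with rfl | hne
    · exact ⟨1, by simp⟩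
    let I : σ × σ → Finset σ := fun α => Finset.univ.filter fun c => r α.2 c ∧ r c α.1
    -- A root with shortest interval can be removed without losing closure, since it is not an
    -- enlargement of another root of `R`.
    obtain ⟨⟨i, j⟩, hβ, hmin⟩ := R.exists_min_image (fun α => (I α).card) hne
    have hij : r j i := hneg _ hβ
    obtain ⟨N, hN⟩ := ih (R.erase (i, j)) (Finset.erase_ssubset hβ)
      (fun α hα => hneg α (Finset.mem_of_mem_erase hα))
      (by
        intro a b l hab hl
        have habR := Finset.mem_of_mem_erase hab
        refine Finset.mem_erase.2 ⟨fun e => ?_, h1 a b l habR hl⟩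
        obtain ⟨rfl, rfl⟩ := Prod.mk.inj e
        refine absurd (hmin _ habR) (not_le.2 (Finset.card_lt_card ?_))
        rw [Finset.ssubset_iff_of_subset]
        · exact ⟨b, by simp [I, hl, hneg _ habR], by simp [I, irrefl_of r b]⟩
        · intro c hc
          simp only [I, Finset.mem_filter, Finset.mem_univ, true_and] at hc ⊢
          exact ⟨trans_of r hl hc.1, hc.2⟩)
      (by
        intro a b k hab hk
        have habR := Finset.mem_of_mem_erase hab
        refine Finset.mem_erase.2 ⟨fun e => ?_, h2 a b k habR hk⟩
        obtain ⟨rfl, rfl⟩ := Prod.mk.inj e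
        refine absurd (hmin _ habR) (not_le.2 (Finset.card_lt_card ?_))
        rw [Finset.ssubset_iff_of_subset]
        · exact ⟨a, by simp [I, hk, hneg _ habR], by simp [I, irrefl_of r a]⟩
        · intro c hc
          simp only [I, Finset.mem_filter, Finset.mem_univ, true_and] at hc ⊢
          exact ⟨hc.1, trans_of r hc.2 hk⟩)
    set G := Submodule.span F ((fun α : σ × σ => y α.1 α.2) '' (R.erase (i, j) : Finset (σ × σ))) with hG
    have hmem : ∀ a b, (a, b) ∈ R → (a, b) ≠ (i, j) → y a b ∈ G := fun a b h h' =>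
      Submodule.subset_span ⟨(a, b), Finset.mem_erase.2 ⟨h', h⟩, rfl⟩
    -- The bracket with `y k l` yields `y i l` or `y k j`. Both belong to strictly larger intervals
    -- than the one of `(i, j)` and hence to `G`.
    have hyG : ∀ g ∈ G, ∃ g₁ ∈ G, ∃ g₂ ∈ G, y i j * g = g₁ * y i j + g₂ := by
      intro g hg
      induction hg using Submodule.span_induction with
      | mem x hx =>
        obtain ⟨⟨k, l⟩, hkl₀, rfl⟩ := hx
        obtain ⟨hkl', hkl⟩ := Finset.mem_erase.1 hkl₀
        have hlk : r l k := hneg _ hkl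
        obtain ⟨a, ha⟩ := hbr i j k l hij hlk
        refine ⟨a • y k l, G.smul_mem _ (hmem _ _ hkl hkl'), _, ?_, (sub_eq_iff_eq_add'.1 ha).trans
          (by rw [smul_mul_assoc])⟩
        refine G.sub_mem ?_ (G.smul_mem _ ?_)
        · split_ifs with e
          · subst e
            refine hmem _ _ (h2 _ _ _ hkl hij) fun e => ?_
            have := (Prod.mk.inj e).2
            exact irrefl_of r l (by rw [← this] at hlk; exact hlk)
          · exact G.zero_mem
        · split_ifs with e
          · subst e
            refine hmem _ _ (h1 _ _ _ hkl hij) fun e => ?_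
            have := (Prod.mk.inj e).1
            exact irrefl_of r k (by rw [← this] at hlk; exact hlk)
          · exact G.zero_mem
      | zero => exact ⟨0, G.zero_mem, 0, G.zero_mem, by simp⟩
      | add x x' _ _ hx hx' =>
        obtain ⟨a, ha, b, hb, e⟩ := hx
        obtain ⟨a', ha', b', hb', e'⟩ := hx'
        exact ⟨a + a', G.add_mem ha ha', b + b', G.add_mem hb hb', by
          rw [mul_add, e, e', add_mul]; abel⟩
      | smul c x _ hx =>
        obtain ⟨a, ha, b, hb, e⟩ := hx
        exact ⟨c • a, G.smul_mem c ha, c • b, G.smul_mem c hb, by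
          rw [mul_smul_comm, e, smul_mul_assoc, smul_add]⟩
    refine ⟨p * N, ?_⟩
    have hsup : Submodule.span F ((fun α : σ × σ => y α.1 α.2) '' R)
        = G ⊔ Submodule.span F {y i j} := by
      rw [hG, ← Submodule.span_union]
      congr 1
      conv_lhs => rw [← Finset.insert_erase hβ]
      rw [Finset.coe_insert, Set.image_insert_eq, Set.union_singleton]
    rw [hsup]
    exact sup_span_singleton_pow_eq_bot hN (hy i j hij) hyG
  obtain ⟨N, hN⟩ := main (Finset.univ.filter fun α : σ × σ => r α.2 α.1) (by simp)
    (by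
      intro i j l h hl
      simp only [Finset.mem_filter, Finset.mem_univ, true_and] at h ⊢
      exact trans_of r hl h)
    (by
      intro i j k h hk
      simp only [Finset.mem_filter, Finset.mem_univ, true_and] at h ⊢
      exact trans_of r h hk)
  refine ⟨N, ?_⟩
  rw [← hN]
  congr 2
  ext x
  simp [eq_comm]

/-- A module generated from a nonzero vector by the unital algebra of a nilpotent space has a greatest
proper submodule. -/
theorem exists_greatest_proper {Z : Type*} [AddCommGroup Z] [Module U Z] {v : Z} (hv : v ≠ 0)
    {s : Set U} {N : ℕ} (hN : Submodule.span F s ^ N = ⊥)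
    (hspan : ∀ z : Z, ∃ b ∈ Algebra.adjoin F s, z = b • v) :
    ∃ K : Submodule U Z, K ≠ ⊤ ∧ ∀ V : Submodule U Z, V ≠ ⊤ → V ≤ K := by
  set B := Algebra.adjoin F s with hB
  set G := Submodule.span F s with hG
  let I : Submodule F U := G * B.toSubmodule
  have hGB : G ≤ B.toSubmodule := Submodule.span_le.2 Algebra.subset_adjoin
  have hsG : s ⊆ G := Submodule.subset_span
  have hBG : B.toSubmodule * G ≤ G * B.toSubmodule :=
    adjoin_mul_le fun x hx g hg => Submodule.mul_mem_mul (hsG hx) (hGB hg)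
  have hnil : ∀ a ∈ I, IsNilpotent a := by
    intro a ha
    refine ⟨N, ?_⟩
    have h1 := mul_subalgebra_pow_le hBG N (Submodule.pow_mem_pow I ha N)
    rwa [hN, Submodule.bot_mul, Submodule.mem_bot] at h1
  have hII : ∀ a ∈ I, ∀ b ∈ B, a * b ∈ I := by
    intro a ha b hb
    have h1 : a * b ∈ I * B.toSubmodule := Submodule.mul_mem_mul ha hb
    rwa [show I * B.toSubmodule = I by simp only [I, mul_assoc, B.isIdempotentElem_toSubmodule.eq]] at h1
  have hIB : I ≤ B.toSubmodule := (mul_le_mul' hGB le_rfl).trans (B.isIdempotentElem_toSubmodule.eq).le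
  have hdec : ∀ b ∈ B, ∃ c : F, ∃ a ∈ I, b = algebraMap F U c + a := by
    intro b hb
    induction hb using Algebra.adjoin_induction with
    | mem x hx =>
      refine ⟨0, x, ?_, by simp⟩
      rw [← mul_one x]
      exact Submodule.mul_mem_mul (hsG hx) B.one_mem
    | algebraMap c => exact ⟨c, 0, I.zero_mem, by simp⟩
    | add x y _ _ hx hy =>
      obtain ⟨c, a, ha, rfl⟩ := hx
      obtain ⟨c', a', ha', rfl⟩ := hy
      exact ⟨c + c', a + a', I.add_mem ha ha', by rw [map_add]; abel⟩
    | mul x y _ hy' hx hy =>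
      obtain ⟨c, a, ha, rfl⟩ := hx
      obtain ⟨c', a', ha', e⟩ := hy
      refine ⟨c * c', c • a' + a * y, I.add_mem (I.smul_mem c ha') (hII a ha y hy'), ?_⟩
      rw [add_mul, map_mul, Algebra.smul_def, ← add_assoc, ← mul_add, ← e]
  -- A nonzero scalar plus a nilpotent element is invertible.
  have hunit : ∀ c : F, c ≠ 0 → ∀ a ∈ I, IsUnit (algebraMap F U c + a) := fun c hc a ha =>
    (hnil a ha).isUnit_add_left_of_commute ((IsUnit.mk0 c hc).map (algebraMap F U))
      (Algebra.commutes c a).symm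
  -- The largest `U`-submodule contained in $Iv$; $Iv$ itself need not be stable under `U`.
  let K : Submodule U Z :=
    { carrier := {z | ∀ u : U, ∃ a ∈ I, u • z = a • v}
      add_mem' := by
        intro z z' hz hz' u
        obtain ⟨a, ha, e⟩ := hz u
        obtain ⟨a', ha', e'⟩ := hz' u
        exact ⟨a + a', I.add_mem ha ha', by rw [smul_add, e, e', add_smul]⟩
      zero_mem' := fun u => ⟨0, I.zero_mem, by simp⟩
      smul_mem' := by
        intro w z hz u
        obtain ⟨a, ha, e⟩ := hz (u * w)
        exact ⟨a, ha, by rw [← mul_smul, e]⟩ }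
  refine ⟨K, ?_, ?_⟩
  · intro hK
    obtain ⟨a, ha, e⟩ := (hK ▸ Submodule.mem_top : v ∈ K) 1
    have h1 : (algebraMap F U 1 + -a) • v = 0 := by
      rw [map_one, add_smul, e, neg_smul, add_neg_cancel]
    obtain ⟨w, hw⟩ := hunit 1 one_ne_zero (-a) (I.neg_mem ha)
    rw [← hw] at h1
    apply hv
    rw [← one_smul U v, ← w.inv_mul, mul_smul, h1, smul_zero]
  · intro V hV z hz u
    obtain ⟨b, hb, e⟩ := hspan (u • z)
    obtain ⟨c, a, ha, rfl⟩ := hdec b hb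
    by_cases hc : c = 0
    · exact ⟨a, ha, by rw [e, hc, map_zero, zero_add]⟩
    · exfalso
      apply hV
      obtain ⟨w, hw⟩ := hunit c hc a ha
      have h1 : v ∈ V := by
        rw [← one_smul U v, ← w.inv_mul, mul_smul, hw, ← e]
        exact V.smul_mem _ (V.smul_mem _ hz)
      rw [eq_top_iff]
      intro x _
      obtain ⟨b, _, rfl⟩ := hspan x
      exact V.smul_mem _ h1

end Nilpotent
end SuperGL
end

noncomputable section
namespace SuperGL

/-! ### Shifting root vectors by their $p$-character -/

section Shift
variable {F : Type*} [Field F] {U : Type*} [Ring U] [Algebra F U]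

theorem mul_self_eq_zero_of_add (h2 : (2 : F) ≠ 0) {x : U}
    (h : x * x - (-1 : F) • (x * x) = 0 - (-1 : F) • (0 : U)) : x * x = 0 := by
  rw [neg_smul, one_smul, smul_zero, sub_zero, sub_neg_eq_add, ← two_smul F] at h
  exact (smul_eq_zero.1 h).resolve_left h2

/-- Constants drop out of commutators, and no constants are subtracted when the sign may differ from
1. The conditions on `c` and `d` say that $\chi$ vanishes on the bracket. -/
theorem bracket_sub_algebraMap {x y z w : U} {P Q : Prop} [Decidable P] [Decidable Q]
    {a b c d s : F} (h : x * y - s • (y * x) = (if P then z else 0) - s • (if Q then w else 0))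
    (hs : s = 1 ∨ a = 0 ∧ b = 0) (hc : P → c = 0) (hd : Q → d = 0) :
    (x - algebraMap F U a) * (y - algebraMap F U b)
        - s • ((y - algebraMap F U b) * (x - algebraMap F U a))
      = (if P then z - algebraMap F U c else 0) - s • (if Q then w - algebraMap F U d else 0) := by
  have e1 : (if P then z - algebraMap F U c else 0) = if P then z else 0 := by
    split_ifs with h
    · rw [hc h, map_zero, sub_zero]
    · rfl
  have e2 : (if Q then w - algebraMap F U d else 0) = if Q then w else 0 := by
    split_ifs with h
    · rw [hd h, map_zero, sub_zero]
    · rfl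
  rw [e1, e2, ← h]
  rcases hs with rfl | ⟨rfl, rfl⟩
  · simp only [sub_mul, mul_sub, one_smul, Algebra.commutes a y, Algebra.commutes b x,
      Algebra.commutes a (algebraMap F U b)]
    abel
  · simp

end Shift

/-! ### Baby Verma modules in standard Levi form -/

section LeviForm
universe u
variable {F : Type u} [Field F] {m n p : ℕ} {r : Fin m ⊕ Fin n → Fin m ⊕ Fin n → Prop}
  {χ : PChar F m n}

/-- The value of `χ` on a matrix unit. -/
abbrev PChar.unit (χ : PChar F m n) (i j : Fin m ⊕ Fin n) : F := PChar.ext χ (Matrix.single i j 1)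

theorem PChar.unit_eq_zero_of_odd {i j : Fin m ⊕ Fin n} (h : (parity i + parity j : ZMod 2) = 1) :
    PChar.unit χ i j = 0 := by
  have : proj F m n 0 (Matrix.single i j 1) = 0 := by
    apply Subtype.ext
    ext a b
    by_cases hab : i = a ∧ j = b
    · obtain ⟨rfl, rfl⟩ := hab
      simp [proj, h]
    · simp [proj, Matrix.single_apply, hab]
  rw [PChar.unit, PChar.ext, LinearMap.comp_apply, this, map_zero]

theorem HasStandardLeviForm.unit_ne_zero [IsStrictTotalOrder (Fin m ⊕ Fin n) r]
    (h : HasStandardLeviForm r χ) {i j : Fin m ⊕ Fin n} (hij : PChar.unit χ i j ≠ 0) :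
    IsEvenSimple r (j, i) := by
  obtain ⟨hB, I, hI, hc⟩ := h
  by_cases hji : j = i
  · subst hji
    exact absurd (hB _ (Submodule.mem_sup_left (single_self_mem_cartan j))) hij
  · by_contra hs
    exact hij ((hc (j, i) hji).2 fun h => hs (hI _ h))

/-- The image of a matrix unit in `u(g, χ)`. -/
abbrev unitι (p : ℕ) (χ : PChar F m n) (i j : Fin m ⊕ Fin n) : ReducedEnv (whole F m n p) χ :=
  ReducedEnv.ι (whole F m n p) χ ⟨Matrix.single i j 1, Submodule.mem_top⟩

theorem unitι_bracket (i j k l : Fin m ⊕ Fin n) :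
    unitι p χ i j * unitι p χ k l
      - sgn F (parity i + parity j) (parity k + parity l) • (unitι p χ k l * unitι p χ i j)
      = (if j = k then unitι p χ i l else 0)
        - sgn F (parity i + parity j) (parity k + parity l) • (if l = i then unitι p χ k j else 0) := by
  rw [ReducedEnv.ι_bracket (whole F m n p) χ _ _ _ _ (single_mem_deg rfl) (single_mem_deg rfl)]
  have e : (⟨superBracket (parity i + parity j) (parity k + parity l) (Matrix.single i j (1 : F))
        (Matrix.single k l 1), Submodule.mem_top⟩ : (whole F m n p).carrier)
      = (if j = k then ⟨Matrix.single i l 1, Submodule.mem_top⟩ else 0)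
        - sgn F (parity i + parity j) (parity k + parity l)
          • (if l = i then ⟨Matrix.single k j 1, Submodule.mem_top⟩ else 0) := by
    apply Subtype.ext
    change superBracket _ _ _ _ = _
    rw [superBracket, single_mul_single_eq, single_mul_single_eq]
    split_ifs <;> simp
  refine (congrArg _ e).trans ?_
  rw [map_sub, map_smul]
  split_ifs <;> simp

variable [hp : Fact p.Prime] [CharP F p] [IsStrictTotalOrder (Fin m ⊕ Fin n) r]

theorem exists_span_shifted_unit_pow_eq_bot (hp2 : 2 < p) (hχ : HasStandardLeviForm r χ)
    [Nontrivial (ReducedEnv (whole F m n p) χ)] :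
    ∃ N, Submodule.span F {x | ∃ i j, r j i ∧
      x = unitι p χ i j - algebraMap F _ (PChar.unit χ i j)} ^ N = ⊥ := by
  have hchar : CharP (ReducedEnv (whole F m n p) χ) p :=
    charP_of_injective_algebraMap (algebraMap F (ReducedEnv (whole F m n p) χ)).injective p
  have h2 : (2 : F) ≠ 0 := by
    have := (CharP.cast_eq_zero_iff F p 2).not.2 (fun h => absurd (Nat.le_of_dvd (by omega) h) (by omega))
    exact_mod_cast this
  refine exists_span_pow_eq_bot (r := r)
    (fun i j => unitι p χ i j - algebraMap F _ (PChar.unit χ i j)) (p := p) ?_ ?_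
  · intro i j hji
    have hne : i ≠ j := by rintro rfl; exact irrefl_of r i hji
    rcases eq_zero_or_eq_one_of_zmod_two (parity i + parity j : ZMod 2) with h | h
    · have h1 := ReducedEnv.ι_pow (whole F m n p) χ ⟨Matrix.single i j 1, Submodule.mem_top⟩
        (single_mem_deg h)
      have h3 : (⟨(Matrix.single i j (1 : F)) ^ p, Submodule.mem_top⟩ : (whole F m n p).carrier) = 0 :=
        Subtype.ext (by rw [single_pow_eq hp.out.two_le, if_neg hne]; rfl)
      have h4 := congrArg (ReducedEnv.ι (whole F m n p) χ) h3
      rw [map_zero] at h4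
      have h5 : unitι p χ i j ^ p = algebraMap F _ (PChar.unit χ i j ^ p) := by
        rw [PChar.unit, PChar.ext_of_mem χ (single_mem_deg h), ← h1]
        exact (sub_eq_self.2 h4).symm
      -- For even roots, Frobenius is additive on commuting elements and $e_{ij}^p=\chi(e_{ij})^p$.
      rw [sub_pow_char_of_commute _ (Algebra.commutes _ _).symm, h5, map_pow, sub_self]
    · have h1 := unitι_bracket (p := p) (χ := χ) i j i j
      rw [h, sgn_one_one, if_neg (Ne.symm hne)] at h1
      have h3 := mul_self_eq_zero_of_add h2 h1
      rw [PChar.unit_eq_zero_of_odd h, map_zero, sub_zero]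
      exact pow_eq_zero_of_le hp2.le (by rw [pow_two, h3])
  · intro i j k l hji hlk
    refine ⟨sgn F (parity i + parity j) (parity k + parity l), ?_⟩
    -- This is where standard Levi form enters: a root with an index strictly in between is not
    -- simple.
    have hz : ∀ a b c, r a b → r b c → PChar.unit χ c a = 0 := by
      intro a b c hab hbc
      by_contra hne
      exact (hχ.unit_ne_zero hne).2.2 ⟨b, hab, hbc⟩
    refine bracket_sub_algebraMap (unitι_bracket (p := p) (χ := χ) i j k l) ?_ ?_ ?_
    · rcases eq_zero_or_eq_one_of_zmod_two (parity i + parity j : ZMod 2) with h | h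
      · exact Or.inl (by rw [h, sgn_zero_left])
      · rcases eq_zero_or_eq_one_of_zmod_two (parity k + parity l : ZMod 2) with h' | h'
        · exact Or.inl (by rw [h', sgn_zero_right])
        · exact Or.inr ⟨PChar.unit_eq_zero_of_odd h, PChar.unit_eq_zero_of_odd h'⟩
    · rintro rfl
      exact hz l j i hlk hji
    · rintro rfl
      exact hz j l k hji hlk

omit hp [CharP F p] in
theorem BabyVerma.exists_smul_gen (hχ : VanishesOnNilPos r χ) {l : Module.Dual F (cartan F m n)}
    (hl : IsWeight p χ l) (z : BabyVerma hχ hl) :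
    ∃ u : ReducedEnv (whole F m n p) χ, z = u • BabyVerma.gen hχ hl := by
  obtain ⟨t, rfl⟩ := Submodule.Quotient.mk_surjective _ z
  induction t using TensorProduct.induction_on with
  | zero => exact ⟨0, by rw [zero_smul]; rfl⟩
  | tmul u c =>
    refine ⟨c • u, ?_⟩
    rw [BabyVerma.gen, ← Submodule.Quotient.mk_smul, TensorProduct.smul_tmul', smul_eq_mul, mul_one,
      TensorProduct.smul_tmul, smul_eq_mul, mul_one]
  | add x y hx hy =>
    obtain ⟨a, ha⟩ := hx
    obtain ⟨b, hb⟩ := hy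
    exact ⟨a + b, by rw [Submodule.Quotient.mk_add, ha, hb, add_smul]⟩

omit hp [CharP F p] in
theorem BabyVerma.borel_smul_gen (hχ : VanishesOnNilPos r χ) {l : Module.Dual F (cartan F m n)}
    (hl : IsWeight p χ l) (x : gl F m n) (hx : x ∈ (borel F m n r p).carrier) :
    ReducedEnv.ι (whole F m n p) χ ⟨x, Submodule.mem_top⟩ • BabyVerma.gen hχ hl
      = algebraMap F (ReducedEnv (whole F m n p) χ) (l (toCartan F m n x)) • BabyVerma.gen hχ hl := by
  have h1 : ReducedEnv.incl (𝔞 := borel F m n r p) (𝔟 := whole F m n p) le_top χ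
      (ReducedEnv.ι _ χ ⟨x, hx⟩) = ReducedEnv.ι (whole F m n p) χ ⟨x, Submodule.mem_top⟩ :=
    ReducedEnv.lift_ι _ _ _ _ _ _
  have h2 : weightChar hχ hl (ReducedEnv.ι _ χ ⟨x, hx⟩) = l (toCartan F m n x) :=
    ReducedEnv.lift_ι _ _ _ _ _ _
  rw [BabyVerma.gen, ← Submodule.Quotient.mk_smul, ← Submodule.Quotient.mk_smul,
    Submodule.Quotient.eq]
  refine Submodule.subset_span ⟨1, ReducedEnv.ι _ χ ⟨x, hx⟩, 1, ?_⟩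
  rw [one_mul, h1, TensorProduct.smul_tmul', TensorProduct.smul_tmul', smul_eq_mul, smul_eq_mul,
    mul_one, mul_one, Algebra.algebraMap_eq_smul_one, TensorProduct.smul_tmul]
  simp [h2]

-- The elements `u` with $uv\in Bv$ form a subspace `T`. It is stable under all matrix units:
-- commute $e_{ij}$ past the first letter of a word in lower generators and induct on the word.
-- Positive and diagonal units reach `v` and act there by scalars.
omit hp [CharP F p] in
theorem BabyVerma.exists_lower_smul_gen (hχ : VanishesOnNilPos r χ)
    {l : Module.Dual F (cartan F m n)} (hl : IsWeight p χ l) (z : BabyVerma hχ hl) :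
    ∃ b ∈ Algebra.adjoin F {x | ∃ i j, r j i ∧
      x = unitι p χ i j - algebraMap F _ (PChar.unit χ i j)}, z = b • BabyVerma.gen hχ hl := by
  set s := {x | ∃ i j, r j i ∧ x = unitι p χ i j - algebraMap F _ (PChar.unit χ i j)} with hs
  set B := Algebra.adjoin F s with hB
  have hBT : ∀ b ∈ B, ∀ u : ReducedEnv (whole F m n p) χ,
      (∃ b ∈ B, u • BabyVerma.gen hχ hl = b • BabyVerma.gen hχ hl) →
      ∃ b' ∈ B, (b * u) • BabyVerma.gen hχ hl = b' • BabyVerma.gen hχ hl := by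
    rintro b hb u ⟨c, hc, e⟩
    exact ⟨b * c, B.mul_mem hb hc, by rw [mul_smul, e, mul_smul]⟩
  let T : Submodule F (ReducedEnv (whole F m n p) χ) :=
    { carrier := {u | ∃ b ∈ B, u • BabyVerma.gen hχ hl = b • BabyVerma.gen hχ hl}
      add_mem' := by
        rintro u u' ⟨b, hb, e⟩ ⟨b', hb', e'⟩
        exact ⟨b + b', B.add_mem hb hb', by rw [add_smul, e, e', add_smul]⟩
      zero_mem' := ⟨0, B.zero_mem, rfl⟩
      smul_mem' := by
        intro c u hu
        rw [Algebra.smul_def]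
        exact hBT _ (B.algebraMap_mem c) u hu }
  have hBT' : ∀ b ∈ B, ∀ u ∈ T, b * u ∈ T := hBT
  have hBsub : ∀ b ∈ B, b ∈ T := fun b hb => ⟨b, hb, rfl⟩
  have hlow : ∀ i j, r j i → unitι p χ i j ∈ B := by
    intro i j hij
    have h1 : unitι p χ i j - algebraMap F _ (PChar.unit χ i j) ∈ B :=
      Algebra.subset_adjoin ⟨i, j, hij, rfl⟩
    have h2 := B.add_mem h1 (B.algebraMap_mem (PChar.unit χ i j))
    rwa [sub_add_cancel] at h2
  have hword : ∀ w ∈ Submonoid.closure s, w ∈ B ∧ ∀ i j, unitι p χ i j * w ∈ T := by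
    intro w hw
    induction hw using Submonoid.closure_induction_left with
    | one =>
      refine ⟨B.one_mem, fun i j => ?_⟩
      rw [mul_one]
      rcases trichotomous_of r i j with h | h | h
      · have hx : Matrix.single i j (1 : F) ∈ (borel F m n r p).carrier := by
          refine Submodule.mem_sup_right fun a b hab => ?_
          rw [Matrix.single_apply, if_neg]
          rintro ⟨rfl, rfl⟩
          exact hab h
        exact ⟨_, B.algebraMap_mem _, BabyVerma.borel_smul_gen hχ hl _ hx⟩
      · subst h
        have hx : Matrix.single i i (1 : F) ∈ (borel F m n r p).carrier :=
          Submodule.mem_sup_left (single_self_mem_cartan i)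
        exact ⟨_, B.algebraMap_mem _, BabyVerma.borel_smul_gen hχ hl _ hx⟩
      · exact hBsub _ (hlow i j h)
    | mul_left g hg w hw ih =>
      obtain ⟨k, l', hlk, rfl⟩ := hg
      obtain ⟨hwB, ih⟩ := ih
      have hgB : unitι p χ k l' - algebraMap F _ (PChar.unit χ k l') ∈ B :=
        Algebra.subset_adjoin ⟨k, l', hlk, rfl⟩
      refine ⟨B.mul_mem hgB hwB, fun i j => ?_⟩
      have hb := sub_eq_iff_eq_add.1 (unitι_bracket (p := p) (χ := χ) i j k l')
      have e : unitι p χ i j * ((unitι p χ k l' - algebraMap F _ (PChar.unit χ k l')) * w)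
          = ((if j = k then unitι p χ i l' * w else 0)
            - sgn F (parity i + parity j) (parity k + parity l') •
              (if l' = i then unitι p χ k j * w else 0))
            + sgn F (parity i + parity j) (parity k + parity l') •
              (unitι p χ k l' * (unitι p χ i j * w))
            - PChar.unit χ k l' • (unitι p χ i j * w) := by
        rw [sub_mul, mul_sub, ← mul_assoc, hb, add_mul, sub_mul, smul_mul_assoc, smul_mul_assoc,
          ← Algebra.smul_def, mul_smul_comm, mul_assoc]
        simp only [ite_mul, zero_mul]
      rw [e]
      refine T.sub_mem (T.add_mem (T.sub_mem ?_ (T.smul_mem _ ?_)) (T.smul_mem _ ?_))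
        (T.smul_mem _ (ih i j))
      · split_ifs
        · exact ih i l'
        · exact T.zero_mem
      · split_ifs
        · exact ih k j
        · exact T.zero_mem
      · exact hBT' _ (hlow k l' hlk) _ (ih i j)
  have hunit : ∀ b ∈ B, ∀ i j, unitι p χ i j * b ∈ T := by
    intro b hb i j
    rw [hB, ← Subalgebra.mem_toSubmodule, Algebra.adjoin_eq_span] at hb
    induction hb using Submodule.span_induction with
    | mem w hw => exact (hword w hw).2 i j
    | zero => rw [mul_zero]; exact T.zero_mem
    | add x y _ _ hx hy => rw [mul_add]; exact T.add_mem hx hy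
    | smul c x _ hx => rw [mul_smul_comm]; exact T.smul_mem c hx
  have hι : ∀ b ∈ B, ∀ x, ReducedEnv.ι (whole F m n p) χ x * b ∈ T := by
    rintro b hb ⟨x, hx⟩
    have e : (⟨x, hx⟩ : (whole F m n p).carrier)
        = ∑ i, ∑ j, x i j • ⟨Matrix.single i j 1, Submodule.mem_top⟩ := by
      apply Subtype.ext
      simp only [Submodule.coe_sum, Submodule.coe_smul, Matrix.smul_single, smul_eq_mul, mul_one]
      exact Matrix.matrix_eq_sum_single x
    rw [e]
    simp only [map_sum, map_smul, Finset.sum_mul, smul_mul_assoc]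
    exact T.sum_mem fun i _ => T.sum_mem fun j _ => T.smul_mem _ (hunit b hb i j)
  -- The stabilizer of `T` is a subalgebra containing the image of $gl(m|n)$, so it is everything.
  let S : Subalgebra F (ReducedEnv (whole F m n p) χ) :=
    { carrier := {u | ∀ t ∈ T, u * t ∈ T}
      mul_mem' := fun {a b} ha hb t ht => by rw [mul_assoc]; exact ha _ (hb _ ht)
      add_mem' := fun {a b} ha hb t ht => by rw [add_mul]; exact T.add_mem (ha _ ht) (hb _ ht)
      algebraMap_mem' := fun c t ht => hBT' _ (B.algebraMap_mem c) t ht }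
  have hS : ∀ u, u ∈ S := ReducedEnv.induction S fun x t ⟨b, hb, e⟩ => by
    obtain ⟨b', hb', e'⟩ := hι b hb x
    exact ⟨b', hb', by rw [mul_smul, e, ← mul_smul, e']⟩
  obtain ⟨u, rfl⟩ := BabyVerma.exists_smul_gen hχ hl z
  obtain ⟨b, hb, e⟩ := hS u 1 (hBsub 1 B.one_mem)
  exact ⟨b, hb, by rw [← e, mul_one]⟩

omit hp [CharP F p] in
theorem BabyVerma.isGraded_sSup {hχ : VanishesOnNilPos r χ}
    {l : Module.Dual F (cartan F m n)} {hl : IsWeight p χ l}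
    (𝒮 : Set (Submodule (ReducedEnv (whole F m n p) χ) (BabyVerma hχ hl)))
    (h : ∀ W ∈ 𝒮, BabyVerma.IsGraded W) : BabyVerma.IsGraded (sSup 𝒮) := by
  have hadd : ∀ i, ∀ a ∈ BabyVerma.part hχ hl i, ∀ b ∈ BabyVerma.part hχ hl i,
      a + b ∈ BabyVerma.part hχ hl i := by
    rintro i _ ⟨u, hu, rfl⟩ _ ⟨w, hw, rfl⟩
    exact ⟨u + w, Submodule.add_mem _ hu hw, by rw [add_smul]⟩
  have hzero : ∀ i, (0 : BabyVerma hχ hl) ∈ BabyVerma.part hχ hl i := fun i =>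
    ⟨0, Submodule.zero_mem _, by rw [zero_smul]⟩
  intro z hz
  rw [sSup_eq_iSup'] at hz
  induction hz using Submodule.iSup_induction' with
  | mem W x hx =>
    obtain ⟨z₀, h₀, z₁, h₁, h₀', h₁', e⟩ := h W W.2 x hx
    exact ⟨z₀, h₀, z₁, h₁, le_sSup W.2 h₀', le_sSup W.2 h₁', e⟩
  | zero => exact ⟨0, hzero 0, 0, hzero 1, Submodule.zero_mem _, Submodule.zero_mem _, by simp⟩
  | add x y _ _ hx hy =>
    obtain ⟨x₀, h₀, x₁, h₁, h₀', h₁', e⟩ := hx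
    obtain ⟨y₀, k₀, y₁, k₁, k₀', k₁', e'⟩ := hy
    exact ⟨x₀ + y₀, hadd 0 _ h₀ _ k₀, x₁ + y₁, hadd 1 _ h₁ _ k₁, Submodule.add_mem _ h₀' k₀',
      Submodule.add_mem _ h₁' k₁', by rw [e, e']; abel⟩

theorem HasStandardLeviForm.gen_ne_zero (hp2 : 2 < p) (hχ : HasStandardLeviForm r χ)
    {l : Module.Dual F (cartan F m n)} (hl : IsWeight p χ l) :
    BabyVerma.gen hχ.vanishesOnNilPos hl ≠ 0 := by
  refine SuperGL.gen_ne_zero _ hl (hasHighestWeight_of_pow_eq hp2 ?_ ?_)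
  · intro i j hij
    obtain ⟨h1, h2, -⟩ := hχ.unit_ne_zero hij
    refine ⟨h1, ?_⟩
    have : ∀ x y : ZMod 2, x + y = 0 → y = x := by decide
    exact this _ _ h2
  -- Since $\chi$ vanishes on $H$ and $e_{ii}^{[p]}=e_{ii}$, the weight condition reads
  -- $\lambda(e_{ii})^p=\lambda(e_{ii})$.
  · intro i
    have h1 := hl ⟨Matrix.single i i 1, single_self_mem_cartan i⟩
    have h2 : PChar.ext χ (Matrix.single i i 1) = 0 :=
      hχ.1 _ (Submodule.mem_sup_left (single_self_mem_cartan i))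
    have h3 : (⟨(Matrix.single i i (1 : F)) ^ p, cartan_pow_mem p (single_self_mem_cartan i)⟩ :
        cartan F m n) = ⟨Matrix.single i i 1, single_self_mem_cartan i⟩ :=
      Subtype.ext ((single_pow_eq hp.out.two_le i i).trans (if_pos rfl))
    rw [h2, zero_pow hp.out.ne_zero, sub_eq_zero] at h1
    rw [h1]
    exact congrArg l h3

end LeviForm
end SuperGL
end

/-! ### The proposition -/

theorem proposition5p16 {F : Type*} [Field F] [IsAlgClosed F] (p : ℕ) [Fact p.Prime] [CharP F p]
    (hp : 2 < p) (m n : ℕ)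
    (r : Fin m ⊕ Fin n → Fin m ⊕ Fin n → Prop) [IsStrictTotalOrder (Fin m ⊕ Fin n) r]
    (χ : SuperGL.PChar F m n) (hχ : SuperGL.HasStandardLeviForm r χ)
    (l : Module.Dual F (SuperGL.cartan F m n)) (hl : SuperGL.IsWeight p χ l) :
    (∃! V : Submodule (SuperGL.ReducedEnv (SuperGL.whole F m n p) χ)
        (SuperGL.BabyVerma hχ.vanishesOnNilPos hl), IsCoatom V) ∧
    (∃! V : Submodule (SuperGL.ReducedEnv (SuperGL.whole F m n p) χ)
        (SuperGL.BabyVerma hχ.vanishesOnNilPos hl),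
      Maximal (fun W => SuperGL.BabyVerma.IsGraded W ∧ W ≠ ⊤) V) := by
  have hgen := hχ.gen_ne_zero hp hl
  have : Nontrivial (SuperGL.ReducedEnv (SuperGL.whole F m n p) χ) := by
    refine ⟨1, 0, fun h => hgen ?_⟩
    rw [← one_smul (SuperGL.ReducedEnv (SuperGL.whole F m n p) χ)
      (SuperGL.BabyVerma.gen hχ.vanishesOnNilPos hl), h, zero_smul]
  obtain ⟨N, hN⟩ := SuperGL.exists_span_shifted_unit_pow_eq_bot hp hχ
  obtain ⟨K, hK, hmax⟩ := SuperGL.exists_greatest_proper hgen hN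
    (SuperGL.BabyVerma.exists_lower_smul_gen hχ.vanishesOnNilPos hl)
  constructor
  · refine ⟨K, ⟨hK, fun W hW => ?_⟩, fun V hV => ?_⟩
    · by_contra h
      exact absurd (hmax W h) (not_le_of_gt hW)
    · by_contra h
      exact hK (hV.2 K (lt_of_le_of_ne (hmax V hV.1) h))
  -- Whether `K` is graded is not needed: the sum of all graded submodules inside `K` is graded,
  -- proper, and contains every proper graded submodule.
  · set 𝒮 := {W : Submodule (SuperGL.ReducedEnv (SuperGL.whole F m n p) χ)
      (SuperGL.BabyVerma hχ.vanishesOnNilPos hl) | SuperGL.BabyVerma.IsGraded W ∧ W ≤ K} with h𝒮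
    have hgr : SuperGL.BabyVerma.IsGraded (sSup 𝒮) :=
      SuperGL.BabyVerma.isGraded_sSup 𝒮 fun W hW => hW.1
    have hle : sSup 𝒮 ≤ K := sSup_le fun W hW => hW.2
    have hne : sSup 𝒮 ≠ ⊤ := fun h => hK (top_le_iff.1 (h ▸ hle))
    have hub : ∀ W, SuperGL.BabyVerma.IsGraded W ∧ W ≠ ⊤ → W ≤ sSup 𝒮 := fun W hW =>
      le_sSup ⟨hW.1, hmax W hW.2⟩
    refine ⟨sSup 𝒮, ⟨⟨hgr, hne⟩, fun W hW _ => hub W hW⟩, fun V hV => ?_⟩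
    exact le_antisymm (hub V hV.1) (hV.2 ⟨hgr, hne⟩ (hub V hV.1))
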